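/- Let $A$ be a commutative noetherian ring of Krull dimension $3$ whose spectrum is connected (i.e. $0$ and $1$ are the only idempotents of $A$). A symplectic module over $A$ is a pair $(P,\varphi)$ where $P$ is a finitely generated projective $A$-module and $\varphi\colon P\to \mathrm{Hom}_A(P,A)$ is an isomorphism which is alternating, i.e. $\varphi(x)(x)=0$ for all $x\in P$. An isometry between symplectic modules is an $A$-linear isomorphism compatible with the forms. Let $GW^2(A)$ be the Grothendieck group of the commutative monoid of isometry classes of symplectic modules under orthogonal sum, and let $H(A)$ be the symplectic module $A\oplus \mathrm{Hom}_A(A,A)$ with form $h(q,f)(q',f')=f(q')-f'(q)$. Let $Um_4(A)$ be the set of rows $(a_1,\dots,a_4)\in A^4$ whose entries generate the unit ideal, and let $Sp_4(A)\subset GL_4(A)$ be the group of isometries of $H(A)\perp H(A)$, acting on $Um_4(A)$ on the right by matrix multiplication. Then the following are equivalent: 1. every finitely generated projective $A$-module $P$ of constant rank $2$ with trivial determinant, i.e. $\Lambda^2P\cong A$, is free; 2. the quotient of $GW^2(A)$ by the subgroup generated by the class of $H(A)$ is zero, and the orbit set $Um_4(A)/Sp_4(A)$ consists of a single point. -/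

import Mathlib

open Matrix

universe u

/-- A symplectic module over `A`: a finitely generated projective module `P` together with an
isomorphism `φ : P → Hom(P, A)` that is alternating, `φ(x)(x) = 0`. -/
structure SymplecticModule (A : Type u) [CommRing A] where
  /-- the underlying module -/
  carrier : Type u
  [addCommGroup : AddCommGroup carrier]
  [module : Module A carrier]
  [finite : Module.Finite A carrier]
  [projective : Module.Projective A carrier]
  /-- the form, as a map to the dual module -/
  form : carrier →ₗ[A] Module.Dual A carrier
  form_self : ∀ x, form x x = 0
  bijective : Function.Bijective form

namespace SymplecticModule

attribute [instance] addCommGroup module finite projective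

variable {A : Type u} [CommRing A]

/-- `P` and `Q` are isometric: some linear isomorphism carries one form to the other. -/
def Isometric (P Q : SymplecticModule A) : Prop :=
  ∃ e : P.carrier ≃ₗ[A] Q.carrier, ∀ x y, Q.form (e x) (e y) = P.form x y

theorem Isometric.refl (P : SymplecticModule A) : Isometric P P :=
  ⟨LinearEquiv.refl A _, fun _ _ => rfl⟩

theorem Isometric.symm {P Q : SymplecticModule A} : Isometric P Q → Isometric Q P := by
  rintro ⟨e, he⟩
  exact ⟨e.symm, fun x y => by rw [← he, e.apply_symm_apply, e.apply_symm_apply]⟩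

theorem Isometric.trans {P Q R : SymplecticModule A} :
    Isometric P Q → Isometric Q R → Isometric P R := by
  rintro ⟨e, he⟩ ⟨f, hf⟩
  exact ⟨e.trans f, fun x y => by simp only [LinearEquiv.trans_apply, hf, he]⟩

instance isometricSetoid (A : Type u) [CommRing A] : Setoid (SymplecticModule A) where
  r := Isometric
  iseqv := ⟨Isometric.refl, Isometric.symm, Isometric.trans⟩

/-- The zero symplectic module. -/
def zero (A : Type u) [CommRing A] : SymplecticModule A where
  carrier := PUnit.{u + 1}
  form := 0
  form_self _ := rfl
  bijective :=
    ⟨fun _ _ _ => Subsingleton.elim _ _, fun f => ⟨0, LinearMap.ext fun x => by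
      rw [Subsingleton.elim x 0, map_zero, map_zero]⟩⟩

/-- The linear map underlying the form of the orthogonal sum:
`(p, q) ↦ ((p', q') ↦ φ(p)(p') + ψ(q)(q'))`. -/
def orthogonalSumForm (P Q : SymplecticModule A) :
    (P.carrier × Q.carrier) →ₗ[A] Module.Dual A (P.carrier × Q.carrier) :=
  P.form.compl₁₂ (LinearMap.fst A P.carrier Q.carrier) (LinearMap.fst A P.carrier Q.carrier) +
    Q.form.compl₁₂ (LinearMap.snd A P.carrier Q.carrier) (LinearMap.snd A P.carrier Q.carrier)

@[simp]
theorem orthogonalSumForm_apply (P Q : SymplecticModule A) (x y : P.carrier × Q.carrier) :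
    orthogonalSumForm P Q x y = P.form x.1 y.1 + Q.form x.2 y.2 := rfl

/-- The orthogonal sum `P ⊥ Q`. -/
def orthogonalSum (P Q : SymplecticModule A) : SymplecticModule A where
  carrier := P.carrier × Q.carrier
  form := orthogonalSumForm P Q
  form_self x := by simp [P.form_self, Q.form_self]
  bijective := by
    constructor
    · intro x y h
      have h1 : ∀ z, orthogonalSumForm P Q x z = orthogonalSumForm P Q y z := fun z => by rw [h]
      refine Prod.ext (P.bijective.1 (LinearMap.ext fun p => ?_))
        (Q.bijective.1 (LinearMap.ext fun q => ?_))
      · simpa using h1 (p, 0)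
      · simpa using h1 (0, q)
    · intro f
      obtain ⟨p, hp⟩ := P.bijective.2 (f ∘ₗ LinearMap.inl A P.carrier Q.carrier)
      obtain ⟨q, hq⟩ := Q.bijective.2 (f ∘ₗ LinearMap.inr A P.carrier Q.carrier)
      refine ⟨(p, q), LinearMap.ext fun z => ?_⟩
      rw [orthogonalSumForm_apply, hp, hq, LinearMap.comp_apply, LinearMap.comp_apply, ← map_add]
      simp

/-- The linear map underlying the hyperbolic form: `(q, f) ↦ ((q', f') ↦ f(q') - f'(q))`. -/
def hyperbolicForm (A Q : Type u) [CommRing A] [AddCommGroup Q] [Module A Q] :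
    (Q × Module.Dual A Q) →ₗ[A] Module.Dual A (Q × Module.Dual A Q) :=
  LinearMap.mk₂ A (fun x y => x.2 y.1 - y.2 x.1)
    (fun x x' y => by simp only [Prod.fst_add, Prod.snd_add, LinearMap.add_apply, map_add]; abel)
    (fun c x y => by
      simp only [Prod.smul_fst, Prod.smul_snd, LinearMap.smul_apply, map_smul, smul_sub])
    (fun x y y' => by simp only [Prod.fst_add, Prod.snd_add, LinearMap.add_apply, map_add]; abel)
    (fun c x y => by
      simp only [Prod.smul_fst, Prod.smul_snd, LinearMap.smul_apply, map_smul, smul_sub])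

@[simp]
theorem hyperbolicForm_apply (A Q : Type u) [CommRing A] [AddCommGroup Q] [Module A Q]
    (x y : Q × Module.Dual A Q) : hyperbolicForm A Q x y = x.2 y.1 - y.2 x.1 := rfl

/-- The hyperbolic module `H(Q)`, with underlying module `Q ⊕ Hom(Q, A)`. -/
def hyperbolic (A Q : Type u) [CommRing A] [AddCommGroup Q] [Module A Q]
    [Module.Finite A Q] [Module.Projective A Q] : SymplecticModule A where
  carrier := Q × Module.Dual A Q
  form := hyperbolicForm A Q
  form_self x := by simp
  bijective := by
    constructor
    · intro x y h
      have h1 : ∀ z, hyperbolicForm A Q x z = hyperbolicForm A Q y z := fun z => by rw [h]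
      refine Prod.ext ?_ (LinearMap.ext fun q => by simpa using h1 (q, 0))
      refine (Module.bijective_dual_eval A Q).1 (LinearMap.ext fun f => ?_)
      simpa using h1 (0, f)
    · intro g
      obtain ⟨q, hq⟩ := (Module.bijective_dual_eval A Q).2
        (g ∘ₗ LinearMap.inr A Q (Module.Dual A Q))
      refine ⟨(-q, g ∘ₗ LinearMap.inl A Q (Module.Dual A Q)), LinearMap.ext fun z => ?_⟩
      have h2 : z.2 q = g (0, z.2) := by simpa using LinearMap.congr_fun hq z.2
      rw [hyperbolicForm_apply, map_neg, sub_neg_eq_add, h2, LinearMap.comp_apply,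
        LinearMap.inl_apply, ← map_add]
      simp

end SymplecticModule

/-- The isometry classes of symplectic modules over `A`. -/
def SymplecticClass (A : Type u) [CommRing A] : Type (u + 1) :=
  Quotient (SymplecticModule.isometricSetoid A)

/-- Addition of isometry classes is induced by the orthogonal sum. -/
instance SymplecticClass.instAdd (A : Type u) [CommRing A] : Add (SymplecticClass A) where
  add := Quotient.map₂ SymplecticModule.orthogonalSum (by
    rintro P P' ⟨e, he⟩ Q Q' ⟨f, hf⟩
    refine ⟨LinearEquiv.prodCongr e f, fun x y => ?_⟩
    exact congrArg₂ (· + ·) (he x.1 y.1) (hf x.2 y.2))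

instance SymplecticClass.instZero (A : Type u) [CommRing A] : Zero (SymplecticClass A) where
  zero := Quotient.mk _ (SymplecticModule.zero A)

/-- Isometry classes form a commutative monoid under orthogonal sum. -/
instance SymplecticClass.instAddCommMonoid (A : Type u) [CommRing A] :
    AddCommMonoid (SymplecticClass A) where
  nsmul := nsmulRec
  add_assoc := by
    rintro ⟨P⟩ ⟨Q⟩ ⟨R⟩
    refine Quotient.sound ⟨LinearEquiv.prodAssoc A P.carrier Q.carrier R.carrier, fun x y => ?_⟩
    exact (add_assoc (P.form x.1.1 y.1.1) (Q.form x.1.2 y.1.2) (R.form x.2 y.2)).symm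
  zero_add := by
    rintro ⟨P⟩
    refine Quotient.sound ⟨LinearEquiv.uniqueProd (M₂ := PUnit.{u + 1}), fun x y => ?_⟩
    exact (zero_add (P.form x.2 y.2)).symm
  add_zero := by
    rintro ⟨P⟩
    refine Quotient.sound ⟨LinearEquiv.prodUnique (M₂ := PUnit.{u + 1}), fun x y => ?_⟩
    exact (add_zero (P.form x.1 y.1)).symm
  add_comm := by
    rintro ⟨P⟩ ⟨Q⟩
    refine Quotient.sound ⟨LinearEquiv.prodComm A P.carrier Q.carrier, fun x y => ?_⟩
    exact add_comm (Q.form x.2 y.2) (P.form x.1 y.1)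

/-- The Grothendieck-Witt group `GW²(A)`. -/
abbrev GW2 (A : Type u) [CommRing A] : Type (u + 1) :=
  Algebra.GrothendieckAddGroup (SymplecticClass A)

/-- The class of a symplectic module in `GW²(A)`. -/
def GW2.mk {A : Type u} [CommRing A] (P : SymplecticModule A) : GW2 A :=
  Algebra.GrothendieckAddGroup.of (Quotient.mk _ P : SymplecticClass A)

/-- The quotient of `GW²(A)` by the subgroup generated by the class of `H(A)`. -/
abbrev ReducedGW2 (A : Type u) [CommRing A] : Type (u + 1) :=
  GW2 A ⧸ AddSubgroup.zmultiples (GW2.mk (SymplecticModule.hyperbolic A A))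

/-- Unimodular rows `Um_ι(A)`: rows indexed by `ι` whose entries generate the unit ideal. -/
def UnimodularRow (ι A : Type*) [CommRing A] : Type _ :=
  {v : ι → A // Ideal.span (Set.range v) = ⊤}

/-- The right action `v ↦ v * M` of `Sp_{2n}(A)` on `Um_{2n}(A)`, as an action of the opposite
group. Rows are indexed by `Fin n ⊕ Fin n`; `Matrix.symplecticGroup` is the isometry group of
`H(A) ⊥ ... ⊥ H(A)` (`n` summands) in the basis `e₁, ..., eₙ, e₁*, ..., eₙ*`. -/
instance UnimodularRow.instMulAction (n : ℕ) (A : Type*) [CommRing A] :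
    MulAction (symplecticGroup (Fin n) A)ᵐᵒᵖ (UnimodularRow (Fin n ⊕ Fin n) A) where
  smul M v := ⟨v.1 ᵥ* (M.unop : Matrix (Fin n ⊕ Fin n) (Fin n ⊕ Fin n) A), by
    obtain ⟨c, hc⟩ := Ideal.mem_span_range_iff_exists_fun.1 ((Ideal.eq_top_iff_one _).1 v.2)
    refine (Ideal.eq_top_iff_one _).2 (Ideal.mem_span_range_iff_exists_fun.2
      ⟨((M.unop⁻¹ : symplecticGroup (Fin n) A) :
        Matrix (Fin n ⊕ Fin n) (Fin n ⊕ Fin n) A) *ᵥ c, ?_⟩)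
    have hM : (M.unop : Matrix (Fin n ⊕ Fin n) (Fin n ⊕ Fin n) A) *
        ((M.unop⁻¹ : symplecticGroup (Fin n) A) :
          Matrix (Fin n ⊕ Fin n) (Fin n ⊕ Fin n) A) = 1 :=
      congrArg Subtype.val (mul_inv_cancel M.unop)
    change _ ⬝ᵥ _ = _
    change c ⬝ᵥ v.1 = 1 at hc
    rw [dotProduct_comm, dotProduct_mulVec, vecMul_vecMul, hM, vecMul_one, dotProduct_comm, hc]⟩
  one_smul v := Subtype.ext (vecMul_one v.1)
  mul_smul M N v := Subtype.ext (vecMul_vecMul v.1 _ _).symm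

/-- The set of orbits `Um_{2n}(A) / Sp_{2n}(A)`. -/
abbrev UnimodularOrbits (n : ℕ) (A : Type*) [CommRing A] : Type _ :=
  MulAction.orbitRel.Quotient (symplecticGroup (Fin n) A)ᵐᵒᵖ (UnimodularRow (Fin n ⊕ Fin n) A)

/-!
Rank two projective modules with trivial determinant are the same as symplectic modules of rank two
(the form is an isomorphism `⋀² P ≅ A`), so the first condition says that every symplectic module of
rank two is the hyperbolic plane `H(A)`. What relates this to the second condition is general
position: if the local ranks of a projective module `P` exceed the Krull dimension, then for all
`m ∈ P` and `b ∈ A` there is a `q ∈ P` such that the ideal of all values of functionals on `m + b q`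
has the same radical as the ideal generated by `b` and the values on `m`
(`generalPosition_of_rankAtStalk`). For free modules this is Kronecker's theorem
(`exists_forall_prime_add_mul_mem`), proved by induction on the dimension by passing to boundary
ideals; the projective case follows by using several local frames one after the other.

General position has two consequences in dimension three. With `m = 0` and `b = 1` it yields Serre's
splitting theorem: a symplectic module of rank at least four contains a unimodular vector, hence
splits off a hyperbolic plane (`exists_isometry_hyp`). Moreover, transvections act transitively on
the unimodular vectors of `H(A) ⊥ M` if `M` has rank at least four
(`unimodularTransitive_of_generalPosition`), and transitivity on the unimodular vectors of
`H(A) ⊥ M` permits the cancellation of `H(A)` from `H(A) ⊥ P ≅ H(A) ⊥ M`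
(`UnimodularTransitive.cancel`).

If symplectic modules of rank two are hyperbolic planes, all symplectic modules are therefore sums of
hyperbolic planes, so the reduced Grothendieck-Witt group vanishes; and any two unimodular vectors
of `H(A²)` have isometric orthogonal complements of rank two, so they lie in one orbit. Conversely,
if the reduced Grothendieck-Witt group vanishes, a symplectic module `P` of rank two satisfies
`P ⊥ R ≅ H(A) ⊥ R` for some `R`. As `R ⊥ (-R)` is the hyperbolic module of `R`, one may take `R` to
be a sum of hyperbolic planes. These planes are cancelled one by one: as long as the right hand side
has rank at least six by general position, and in the last step by transitivity on the unimodular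
vectors of `H(A²)`, which are the unimodular rows of length four.
-/

/-! ### General position over rings of bounded Krull dimension -/

/-- The boundary ideal `I + (c) + (√I : c)` lies in no minimal prime of `I`, so a chain of primes
containing it can be prolonged downwards. -/
theorem LTSeries.length_lt_of_boundary_le {A : Type*} [CommRing A] (I : Ideal A) (c : A) {n : ℕ}
    (h : ∀ l : LTSeries (PrimeSpectrum A), I ≤ l.head.asIdeal → l.length < n + 1)
    (l : LTSeries (PrimeSpectrum A)) (hl : I ≤ l.head.asIdeal) (hc : c ∈ l.head.asIdeal)
    (hz : ∀ z, z * c ∈ I.radical → z ∈ l.head.asIdeal) : l.length < n := by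
  obtain ⟨p, hp, hpl⟩ := Ideal.exists_minimalPrimes_le hl
  have hpp : p.IsPrime := hp.1.1
  have hlt : (⟨p, hpp⟩ : PrimeSpectrum A) < l.head := by
    refine lt_of_le_of_ne hpl fun heq => ?_
    have hpe : p = l.head.asIdeal := by rw [← heq]
    -- if no `y * c ^ k` with `y ∉ p` were in `I`, a prime between `I` and `p` would avoid `c ∈ p`,
    -- against minimality
    have hdis : ¬ Disjoint (I : Set A) (p.primeCompl ⊔ Submonoid.powers c : Submonoid A) := by
      intro hd
      obtain ⟨q, hq, hIq, hqd⟩ := Ideal.exists_le_prime_disjoint I _ hd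
      have hqp : q ≤ p := fun x hx => by
        by_contra hxp
        exact Set.disjoint_left.1 hqd hx (Submonoid.mem_sup_left (show x ∈ p.primeCompl from hxp))
      exact Set.disjoint_left.1 hqd (hp.2 ⟨hq, hIq⟩ hqp (hpe ▸ hc))
        (Submonoid.mem_sup_right (Submonoid.mem_powers c))
    obtain ⟨x, hxI, hx⟩ := Set.not_disjoint_iff.1 hdis
    obtain ⟨y, hy, w, ⟨k, rfl⟩, rfl⟩ := Submonoid.mem_sup.1 hx
    refine hy (hpe ▸ hz y ⟨k + 1, ?_⟩)
    have : (y * c) ^ (k + 1) = y ^ k * c * (y * c ^ k) := by ring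
    rw [this]
    exact I.mul_mem_left _ hxI
  have := h (l.cons ⟨p, hpp⟩ hlt) (by simpa using hp.1.2)
  simpa using this

/-- Kronecker's theorem: if all chains of primes above `I` have length `< n`, then `n` elements
`c i` can be moved by multiples of `δ` such that modulo `I` the radical of the ideal they generate
contains `δ`. -/
theorem exists_forall_prime_add_mul_mem {A : Type*} [CommRing A] (δ : A) :
    ∀ (n : ℕ) (I : Ideal A),
      (∀ l : LTSeries (PrimeSpectrum A), I ≤ l.head.asIdeal → l.length < n) →
      ∀ c : Fin n → A, ∃ y : Fin n → A, ∀ p : PrimeSpectrum A, I ≤ p.asIdeal →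
        (∀ i, c i + δ * y i ∈ p.asIdeal) → δ ∈ p.asIdeal
  | 0, I, h, c => ⟨0, fun p hp _ => absurd (h (RelSeries.singleton _ p) hp) (by simp)⟩
  | n + 1, I, h, c => by
    -- the boundary ideal of the last entry
    let B : Ideal A := I.radical.colon {c (Fin.last n)}
    let J : Ideal A := I ⊔ Ideal.span {c (Fin.last n)} ⊔ B
    obtain ⟨y, hy⟩ := exists_forall_prime_add_mul_mem δ n J (fun l hl =>
      LTSeries.length_lt_of_boundary_le I (c (Fin.last n)) h l
        (le_sup_left.trans (le_sup_left.trans hl))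
        (hl (Ideal.mem_sup_left (Ideal.mem_sup_right (Ideal.mem_span_singleton_self _))))
        (fun z hz => hl (Ideal.mem_sup_right
          (Submodule.mem_colon_singleton.2 hz)))) (fun i => c i.castSucc)
    let K : Ideal A := Ideal.span (Set.range fun i => c i.castSucc + δ * y i)
    have hδ : δ ∈ (K ⊔ J).radical := by
      rw [Ideal.radical_eq_sInf]
      refine Submodule.mem_sInf.2 fun p ⟨hp, hpp⟩ => hy ⟨p, hpp⟩ (le_sup_right.trans hp) fun i =>
        hp (Ideal.mem_sup_left (Ideal.subset_span ⟨i, rfl⟩))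
    obtain ⟨k, hk⟩ := hδ
    obtain ⟨j, hj, w, hw, hjw⟩ := Submodule.mem_sup.1 hk
    obtain ⟨w', hw', z, hz, rfl⟩ := Submodule.mem_sup.1 hw
    have hz' : z * c (Fin.last n) ∈ I.radical := Submodule.mem_colon_singleton.1 hz
    refine ⟨Fin.snoc y z, fun p hI hp => ?_⟩
    have hlast : c (Fin.last n) + δ * z ∈ p.asIdeal := by simpa using hp (Fin.last n)
    have hzc : z * c (Fin.last n) ∈ p.asIdeal := p.isPrime.radical_le_iff.2 hI hz'
    have hc : c (Fin.last n) ∈ p.asIdeal := by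
      rcases p.isPrime.mem_or_mem hzc with h1 | h1
      · exact (Ideal.add_mem_iff_left _ (p.asIdeal.mul_mem_left δ h1)).1 hlast
      · exact h1
    have hδz : δ * z ∈ p.asIdeal := (Ideal.add_mem_iff_right _ hc).1 hlast
    have hjp : j ∈ p.asIdeal := by
      refine (Ideal.span_le.2 ?_ : K ≤ p.asIdeal) hj
      rintro _ ⟨i, rfl⟩
      simpa using hp i.castSucc
    have hwp : w' ∈ p.asIdeal :=
      (sup_le hI ((Ideal.span_singleton_le_iff_mem _).2 hc) : _ ≤ p.asIdeal) hw'
    refine p.isPrime.mem_of_pow_mem (k + 1) ?_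
    have : δ ^ (k + 1) = δ * j + δ * w' + δ * z := by
      rw [pow_succ', ← hjw]; ring
    rw [this]
    exact add_mem (add_mem (p.asIdeal.mul_mem_left _ hjp) (p.asIdeal.mul_mem_left _ hwp)) hδz

/-- A local frame of a projective module at a prime: up to a scalar outside the prime, maps from
and to a free module whose rank is the local rank are inverse to each other. -/
theorem Module.exists_frame {A : Type*} [CommRing A] (P : Type*) [AddCommGroup P] [Module A P]
    [Module.Finite A P] [Module.Projective A P] (p : PrimeSpectrum A) {r : ℕ}
    (hr : Module.rankAtStalk (R := A) P p = r) :
    ∃ s ∉ p.asIdeal, ∃ (k : (Fin r → A) →ₗ[A] P) (h : P →ₗ[A] (Fin r → A)),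
      (∀ x, h (k x) = s • x) ∧ ∀ y, k (h y) = s • y := by
  subst hr
  set r := Module.rankAtStalk (R := A) P p
  let S := p.asIdeal.primeCompl
  let mk := LocalizedModule.mkLinearMap S P
  let Ap := Localization.AtPrime p.asIdeal
  let fN : (Fin r → A) →ₗ[A] (Fin r → Ap) :=
    .pi fun i => Algebra.linearMap A Ap ∘ₗ .proj i
  have hfN : IsLocalizedModule S fN := inferInstance
  have : Module.FinitePresentation A P := Module.finitePresentation_of_projective A P
  have : Module.Free Ap (LocalizedModule S P) := Module.free_of_flat_of_isLocalRing
  let l : LocalizedModule S P ≃ₗ[A] (Fin r → Ap) :=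
    (Module.finBasis Ap (LocalizedModule S P)).equivFun.restrictScalars A
  obtain ⟨h, s, hs⟩ := Module.FinitePresentation.exists_lift_of_isLocalizedModule S fN
    (l.toLinearMap ∘ₗ mk)
  obtain ⟨k, t, ht⟩ := Module.FinitePresentation.exists_lift_of_isLocalizedModule S mk
    (l.symm.toLinearMap ∘ₗ fN)
  have h1 : ∀ x, fN (h x) = s.1 • l (mk x) := fun x => LinearMap.congr_fun hs x
  have h2 : ∀ x, mk (k x) = t.1 • l.symm (fN x) := fun x => LinearMap.congr_fun ht x
  obtain ⟨a, ha⟩ := Module.Finite.exists_smul_of_comp_eq_of_isLocalizedModule S fN (h ∘ₗ k)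
    ((s.1 * t.1) • LinearMap.id) (LinearMap.ext fun x => by simp [h1, h2, mul_smul])
  obtain ⟨b, hb⟩ := Module.Finite.exists_smul_of_comp_eq_of_isLocalizedModule S mk (k ∘ₗ h)
    ((s.1 * t.1) • LinearMap.id) (LinearMap.ext fun x => by
      simp [h1, h2, mul_smul, smul_comm t.1 s.1])
  have ha' : ∀ x, a.1 • h (k x) = a.1 • (s.1 * t.1) • x := fun x => LinearMap.congr_fun ha x
  have hb' : ∀ x, b.1 • k (h x) = b.1 • (s.1 * t.1) • x := fun x => LinearMap.congr_fun hb x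
  refine ⟨(a * b * s * t : S).1, (a * b * s * t : S).2, k, (a.1 * b.1) • h, fun x => ?_,
    fun y => ?_⟩
  · rw [LinearMap.smul_apply, mul_comm, mul_smul, ha', smul_smul, smul_smul]
    congr 1; push_cast; ring
  · rw [LinearMap.smul_apply, map_smul, mul_smul, hb', smul_smul, smul_smul]
    congr 1; push_cast; ring

theorem Ideal.eq_top_of_forall_prime_exists {A : Type*} [CommRing A] (I : Ideal A)
    (h : ∀ p : PrimeSpectrum A, ∃ s ∈ I, s ∉ p.asIdeal) : I = ⊤ := by
  by_contra hI
  obtain ⟨M, hM, hIM⟩ := I.exists_le_maximal hI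
  obtain ⟨s, hs, hsM⟩ := h ⟨M, hM.isPrime⟩
  exact hsM (hIM hs)

/-- The elements of `P` can be moved into general position with respect to multiples of `b`: for
every `m` there is a `q` such that the ideal of all values of functionals on `m + b q` contains, up
to radical, the values on `m` as well as `b`. The comparison of radicals is expressed through
primes. -/
def GeneralPosition (A P : Type*) [CommRing A] [AddCommGroup P] [Module A P] : Prop :=
  ∀ (m : P) (b : A), ∃ q : P, ∀ p : PrimeSpectrum A,
    (∀ g : Module.Dual A P, g (m + b • q) ∈ p.asIdeal) →
      b ∈ p.asIdeal ∧ ∀ g : Module.Dual A P, g m ∈ p.asIdeal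

section GeneralPosition

variable {A : Type*} [CommRing A] {P : Type*} [AddCommGroup P] [Module A P]

/-- One frame with denominator `s` puts `m` into general position with respect to `b * s`. -/
theorem exists_generalPosition_of_frame {n r : ℕ} (hr : n ≤ r)
    (hdim : ∀ l : LTSeries (PrimeSpectrum A), l.length < n)
    (s : A) (k : (Fin r → A) →ₗ[A] P) (h : P →ₗ[A] (Fin r → A))
    (hk : ∀ x, h (k x) = s • x) (m : P) (b : A) : ∃ q : P, ∀ p : PrimeSpectrum A,
    (∀ g : Module.Dual A P, g (m + b • q) ∈ p.asIdeal) →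
      b * s ∈ p.asIdeal ∧ ∀ g : Module.Dual A P, g m ∈ p.asIdeal := by
  obtain ⟨y, hy⟩ := exists_forall_prime_add_mul_mem (b * s ^ 2) r ⊥
    (fun l _ => (hdim l).trans_le hr) (h m)
  -- the extra factor `s` keeps the values on `m` unchanged modulo `b * s`
  refine ⟨s • k y, fun p hp => ?_⟩
  have h1 : b * s ∈ p.asIdeal := by
    have := hy p bot_le fun i => by
      have := hp (LinearMap.proj i ∘ₗ h)
      simp only [LinearMap.comp_apply, map_add, map_smul, hk, LinearMap.proj_apply,
        smul_eq_mul] at this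
      convert this using 1; ring
    refine p.isPrime.mem_of_pow_mem 2 ?_
    rw [mul_pow, sq b, mul_assoc]
    exact p.asIdeal.mul_mem_left _ this
  refine ⟨h1, fun g => ?_⟩
  have := hp g
  rw [map_add, map_smul, map_smul, smul_eq_mul, smul_eq_mul, ← mul_assoc] at this
  exact (Ideal.add_mem_iff_left _ (p.asIdeal.mul_mem_right _ h1)).1 this

/-- Projective modules whose local ranks exceed the Krull dimension have general position: finitely
many frames whose denominators generate the unit ideal are used one after the other. -/
theorem generalPosition_of_rankAtStalk [Module.Finite A P] [Module.Projective A P] {n : ℕ}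
    (hdim : ∀ l : LTSeries (PrimeSpectrum A), l.length < n)
    (hrank : ∀ p : PrimeSpectrum A, n ≤ Module.rankAtStalk (R := A) P p) :
    GeneralPosition A P := by
  intro m b
  choose s hs k h hk _ using fun p => Module.exists_frame (A := A) P p rfl
  have htop : Ideal.span (Set.range s) = ⊤ :=
    Ideal.eq_top_of_forall_prime_exists _ fun p => ⟨s p, Ideal.subset_span ⟨p, rfl⟩, hs p⟩
  obtain ⟨T, hT, h1⟩ := Submodule.mem_span_finite_of_mem_span
    ((Ideal.eq_top_iff_one _).1 htop)
  have key : ∀ T : Finset A, (T : Set A) ⊆ Set.range s → ∃ q : P, ∀ p : PrimeSpectrum A,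
      (∀ g : Module.Dual A P, g (m + b • q) ∈ p.asIdeal) →
        (∀ t ∈ T, b * t ∈ p.asIdeal) ∧ ∀ g : Module.Dual A P, g m ∈ p.asIdeal := by
    classical
    intro T
    induction T using Finset.induction_on with
    | empty => exact fun _ => ⟨0, fun p hp => ⟨by simp, by simpa using hp⟩⟩
    | insert t T _ ih =>
      intro hT
      rw [Finset.coe_insert, Set.insert_subset_iff] at hT
      obtain ⟨q, hq⟩ := ih hT.2
      obtain ⟨x, rfl⟩ := hT.1
      obtain ⟨q', hq'⟩ := exists_generalPosition_of_frame (hrank x) hdim (s x) (k x) (h x) (hk x)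
        (m + b • q) b
      refine ⟨q + q', fun p hp => ?_⟩
      obtain ⟨h2, h3⟩ := hq' p (by simpa only [smul_add, add_assoc] using hp)
      obtain ⟨h4, h5⟩ := hq p h3
      exact ⟨by simpa using ⟨h2, h4⟩, h5⟩
  obtain ⟨q, hq⟩ := key T hT
  refine ⟨q, fun p hp => ⟨?_, (hq p hp).2⟩⟩
  have : Ideal.span (T : Set A) ≤ p.asIdeal.colon {b} := Ideal.span_le.2 fun t ht =>
    Submodule.mem_colon_singleton.2 (by simpa [mul_comm] using (hq p hp).1 t ht)
  simpa using Submodule.mem_colon_singleton.1 (this h1)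

/-- Serre's splitting theorem, in terms of a unimodular element. -/
theorem GeneralPosition.exists_dual_apply_eq_one (h : GeneralPosition A P) :
    ∃ (q : P) (g : Module.Dual A P), g q = 1 := by
  obtain ⟨q, hq⟩ := h 0 1
  have htop : LinearMap.range (Module.Dual.eval A P q) = ⊤ := by
    refine Ideal.eq_top_of_forall_prime_exists _ fun p => ?_
    by_contra! hcon
    refine p.isPrime.ne_top ((Ideal.eq_top_iff_one _).2 (hq p fun g => ?_).1)
    simpa using hcon _ ⟨g, rfl⟩
  obtain ⟨g, hg⟩ := LinearMap.range_eq_top.1 htop 1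
  exact ⟨q, g, hg⟩

end GeneralPosition

/-! ### Symplectic modules of small rank -/

theorem LinearMap.pi_apply_eq_sum_single {A P ι : Type*} [CommRing A] [AddCommGroup P] [Module A P]
    [Fintype ι] [DecidableEq ι] (k : (ι → A) →ₗ[A] P) (v : ι → A) :
    k v = ∑ i, v i • k (Pi.single i 1) := by
  have hv : v = ∑ i, v i • Pi.single i (1 : A) := by
    ext j
    simp [Finset.sum_apply, Pi.single_apply]
  conv_lhs => rw [hv]
  simp only [map_sum, map_smul]

namespace SymplecticModule

variable {A : Type u} [CommRing A]

theorem form_neg (N : SymplecticModule A) (x y : N.carrier) : N.form x y = -N.form y x := by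
  have := N.form_self (x + y)
  simp only [map_add, LinearMap.add_apply, N.form_self] at this
  linear_combination this

/-- Locally, the form is nondegenerate: the Gram determinant of the vectors of a frame is a unit at
the prime. -/
theorem det_gram_notMem (N : SymplecticModule A) (p : PrimeSpectrum A) {r : ℕ} {s : A}
    (hs : s ∉ p.asIdeal) {k : (Fin r → A) →ₗ[A] N.carrier} {h : N.carrier →ₗ[A] (Fin r → A)}
    (hk : ∀ x, h (k x) = s • x) (hh : ∀ y, k (h y) = s • y) :
    (Matrix.of fun i j => N.form (k (Pi.single i 1)) (k (Pi.single j 1))).det ∉ p.asIdeal := by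
  choose y hy using fun i => N.bijective.2 (LinearMap.proj i ∘ₗ h)
  have key : (Matrix.of fun i j => h (y i) j) *
      (Matrix.of fun i j => N.form (k (Pi.single i 1)) (k (Pi.single j 1))) = s ^ 2 • 1 := by
    ext i l
    have h1 : s • N.form (y i) (k (Pi.single l 1)) = s ^ 2 * (1 : Matrix (Fin r) (Fin r) A) i l := by
      rw [hy i, LinearMap.comp_apply, hk, LinearMap.proj_apply]
      simp [Matrix.one_apply, Pi.single_apply, sq]
    have h2 : s • N.form (y i) = N.form (k (h (y i))) := by rw [hh, map_smul]
    rw [← LinearMap.smul_apply, h2, LinearMap.pi_apply_eq_sum_single k (h (y i))] at h1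
    rw [Matrix.mul_apply, Matrix.smul_apply, smul_eq_mul, ← h1]
    simp [map_sum, LinearMap.sum_apply]
  intro hdet
  have h3 := congrArg Matrix.det key
  rw [Matrix.det_mul, Matrix.det_smul, Matrix.det_one, mul_one] at h3
  exact hs (p.isPrime.mem_of_pow_mem _ (p.isPrime.mem_of_pow_mem _
    (h3 ▸ p.asIdeal.mul_mem_left _ hdet)))

theorem rankAtStalk_ne_one (N : SymplecticModule A) (p : PrimeSpectrum A) :
    Module.rankAtStalk (R := A) N.carrier p ≠ 1 := by
  intro hr
  obtain ⟨s, hs, k, h, hk, hh⟩ := Module.exists_frame N.carrier p hr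
  refine N.det_gram_notMem p hs hk hh ?_
  simp [N.form_self]

/-- Rank three is impossible because the determinant of an alternating `3 × 3` matrix vanishes. -/
theorem rankAtStalk_ne_three (N : SymplecticModule A) (p : PrimeSpectrum A) :
    Module.rankAtStalk (R := A) N.carrier p ≠ 3 := by
  intro hr
  obtain ⟨s, hs, k, h, hk, hh⟩ := Module.exists_frame N.carrier p hr
  refine N.det_gram_notMem p hs hk hh ?_
  convert p.asIdeal.zero_mem
  simp only [Matrix.det_fin_three, Matrix.of_apply, N.form_self]
  rw [N.form_neg (k (Pi.single 1 1)) (k (Pi.single 0 1)),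
    N.form_neg (k (Pi.single 2 1)) (k (Pi.single 0 1)),
    N.form_neg (k (Pi.single 2 1)) (k (Pi.single 1 1))]
  ring

end SymplecticModule

section ExteriorSquare

variable {A : Type*} [CommRing A] {P : Type*} [AddCommGroup P] [Module A P]

/-- The exterior product `x ∧ y` as a bilinear map to `⋀² P`. -/
noncomputable def wedge (A P : Type*) [CommRing A] [AddCommGroup P] [Module A P] :
    P →ₗ[A] P →ₗ[A] ⋀[A]^2 P :=
  have swap (x y : P) : exteriorPower.ιMulti A 2 ![x, y] = -exteriorPower.ιMulti A 2 ![y, x] := by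
    rw [← AlternatingMap.map_swap _ _ (zero_ne_one (α := Fin 2))]
    congr 1
    ext i
    fin_cases i <;> simp
  LinearMap.mk₂ A (fun x y => exteriorPower.ιMulti A 2 ![x, y])
    (fun x x' y => AlternatingMap.map_vecCons_add _ _ _ _)
    (fun c x y => AlternatingMap.map_vecCons_smul _ _ _ _)
    (fun x y y' => by
      rw [swap x (y + y'), AlternatingMap.map_vecCons_add, swap x y, swap x y', neg_add])
    (fun c x y => by rw [swap x (c • y), AlternatingMap.map_vecCons_smul, swap x y, smul_neg])

theorem wedge_apply (x y : P) : wedge A P x y = exteriorPower.ιMulti A 2 ![x, y] := rfl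

theorem wedge_self (x : P) : wedge A P x x = 0 :=
  (exteriorPower.ιMulti A 2).map_eq_zero_of_eq ![x, x] (i := 0) (j := 1) rfl zero_ne_one

theorem wedge_neg (x y : P) : wedge A P x y = -wedge A P y x := by
  have := wedge_self (A := A) (x + y)
  simp only [map_add, LinearMap.add_apply, wedge_self, zero_add, add_zero] at this
  exact eq_neg_of_add_eq_zero_right this

/-- With respect to a frame of rank two, the exterior square is generated, up to the denominator, by
the product of the two frame vectors. -/
theorem exists_smul_eq_smul_wedge {s : A} {k : (Fin 2 → A) →ₗ[A] P} {h : P →ₗ[A] (Fin 2 → A)}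
    (hh : ∀ y, k (h y) = s • y) (z : ⋀[A]^2 P) :
    ∃ d : A, s ^ 2 • z = d • wedge A P (k (Pi.single 0 1)) (k (Pi.single 1 1)) := by
  have hz : z ∈ Submodule.span A (Set.range (exteriorPower.ιMulti A 2 (M := P))) := by
    rw [exteriorPower.ιMulti_span]; trivial
  induction hz using Submodule.span_induction with
  | mem z hz =>
    obtain ⟨v, rfl⟩ := hz
    refine ⟨h (v 0) 0 * h (v 1) 1 - h (v 0) 1 * h (v 1) 0, ?_⟩
    have hv : v = ![v 0, v 1] := by ext i; fin_cases i <;> rfl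
    have h1 : ∀ y, s • y = h y 0 • k (Pi.single 0 1) + h y 1 • k (Pi.single 1 1) := fun y => by
      rw [← hh, LinearMap.pi_apply_eq_sum_single k (h y), Fin.sum_univ_two]
    have h2 : s ^ 2 • wedge A P (v 0) (v 1) = wedge A P (s • v 0) (s • v 1) := by
      rw [map_smul, map_smul, LinearMap.smul_apply, smul_smul, sq]
    rw [hv, ← wedge_apply, h2, h1, h1]
    simp only [map_add, map_smul, LinearMap.add_apply, LinearMap.smul_apply, wedge_self,
      wedge_neg (k (Pi.single 1 1)) (k (Pi.single 0 1)), cons_val_zero, cons_val_one]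
    module
  | zero => exact ⟨0, by simp⟩
  | add x y _ _ hx hy =>
    obtain ⟨d, hd⟩ := hx
    obtain ⟨d', hd'⟩ := hy
    exact ⟨d + d', by rw [smul_add, hd, hd', add_smul]⟩
  | smul c x _ hx =>
    obtain ⟨d, hd⟩ := hx
    exact ⟨c * d, by rw [smul_comm, hd, smul_smul]⟩

end ExteriorSquare

namespace SymplecticModule

variable {A : Type u} [CommRing A]

/-- The form as an alternating map. -/
def alternatingForm (N : SymplecticModule A) : N.carrier [⋀^Fin 2]→ₗ[A] A where
  toFun v := N.form (v 0) (v 1)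
  map_update_add' v i x y := by fin_cases i <;> simp
  map_update_smul' v i c x := by fin_cases i <;> simp
  map_eq_zero_of_eq' v i j hv hij := by
    have h01 : v 0 = v 1 := by
      fin_cases i <;> fin_cases j <;> simp_all
    simp [h01, N.form_self]

/-- A symplectic module of rank two has trivial determinant: its form is an isomorphism
`⋀² N ≅ A`. -/
theorem nonempty_exteriorPower_equiv (N : SymplecticModule A)
    (hN : ∀ p : PrimeSpectrum A, Module.rankAtStalk (R := A) N.carrier p = 2) :
    Nonempty ((⋀[A]^2 N.carrier) ≃ₗ[A] A) := by
  let ω : ⋀[A]^2 N.carrier →ₗ[A] A := exteriorPower.alternatingMapLinearEquiv N.alternatingForm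
  have hω : ∀ x y, ω (wedge A N.carrier x y) = N.form x y := fun x y => by
    rw [wedge_apply, exteriorPower.alternatingMapLinearEquiv_apply_ιMulti]; rfl
  have hdet : ∀ (k : (Fin 2 → A) →ₗ[A] N.carrier),
      (Matrix.of fun i j => N.form (k (Pi.single i 1)) (k (Pi.single j 1))).det =
        N.form (k (Pi.single 0 1)) (k (Pi.single 1 1)) ^ 2 := fun k => by
    simp only [Matrix.det_fin_two, Matrix.of_apply, N.form_self]
    rw [N.form_neg (k (Pi.single 1 1))]
    ring
  refine ⟨LinearEquiv.ofBijective ω ⟨?_, ?_⟩⟩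
  · refine (injective_iff_map_eq_zero ω).2 fun z hz => ?_
    have htop : LinearMap.ker (LinearMap.toSpanSingleton A _ z) = ⊤ := by
      refine Ideal.eq_top_of_forall_prime_exists _ fun p => ?_
      obtain ⟨s, hs, k, h, hk, hh⟩ := Module.exists_frame N.carrier p (hN p)
      have hu := N.det_gram_notMem p hs hk hh
      rw [hdet] at hu
      obtain ⟨d, hd⟩ := exists_smul_eq_smul_wedge hh z
      have h1 := congrArg ω hd
      rw [map_smul, map_smul, hz, hω, smul_zero, smul_eq_mul] at h1
      refine ⟨N.form (k (Pi.single 0 1)) (k (Pi.single 1 1)) ^ 2 * s ^ 2, ?_, fun hmem => ?_⟩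
      · rw [LinearMap.mem_ker, LinearMap.toSpanSingleton_apply, mul_smul, hd, smul_smul, sq,
          mul_assoc, mul_comm _ d, ← h1, mul_zero, zero_smul]
      · exact (p.isPrime.mem_or_mem hmem).elim hu fun h2 => hs (p.isPrime.mem_of_pow_mem _ h2)
    have := (Ideal.eq_top_iff_one _).1 htop
    simpa using this
  · refine LinearMap.range_eq_top.1 (Ideal.eq_top_of_forall_prime_exists _ fun p => ?_)
    obtain ⟨s, hs, k, h, hk, hh⟩ := Module.exists_frame N.carrier p (hN p)
    refine ⟨_, ⟨_, hω (k (Pi.single 0 1)) (k (Pi.single 1 1))⟩, fun hmem => ?_⟩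
    refine N.det_gram_notMem p hs hk hh ?_
    rw [hdet, sq]
    exact p.asIdeal.mul_mem_left _ hmem

/-- A projective module of rank two with trivial determinant carries a symplectic form, namely
`(x, y) ↦ x ∧ y`. -/
theorem exists_of_exteriorPower_equiv (P : Type u) [AddCommGroup P] [Module A P]
    [Module.Finite A P] [Module.Projective A P]
    (hP : ∀ p : PrimeSpectrum A, Module.rankAtStalk (R := A) P p = 2)
    (e : (⋀[A]^2 P) ≃ₗ[A] A) :
    ∃ N : SymplecticModule A, Nonempty (N.carrier ≃ₗ[A] P) := by
  let φ : P →ₗ[A] Module.Dual A P := (wedge A P).compr₂ e.toLinearMap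
  have hφ : ∀ x y, φ x y = e (wedge A P x y) := fun x y => rfl
  have hself : ∀ x, φ x x = 0 := fun x => by rw [hφ, wedge_self, map_zero]
  have hneg : ∀ x y, φ x y = -φ y x := fun x y => by rw [hφ, wedge_neg, map_neg, hφ]
  -- the data of a frame at a prime, together with the invertible value of the form on it
  have frame : ∀ p : PrimeSpectrum A, ∃ s ∉ p.asIdeal, ∃ (x₀ x₁ : P) (g₀ g₁ : Module.Dual A P),
      (∀ y, s • y = g₀ y • x₀ + g₁ y • x₁) ∧ φ x₀ x₁ ∉ p.asIdeal := fun p => by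
    obtain ⟨s, hs, k, h, hk, hh⟩ := Module.exists_frame P p (hP p)
    refine ⟨s, hs, k (Pi.single 0 1), k (Pi.single 1 1), LinearMap.proj 0 ∘ₗ h,
      LinearMap.proj 1 ∘ₗ h, fun y => ?_, fun hmem => ?_⟩
    · rw [← hh, LinearMap.pi_apply_eq_sum_single k (h y), Fin.sum_univ_two]
      rfl
    · obtain ⟨d, hd⟩ := exists_smul_eq_smul_wedge hh (e.symm 1)
      have h1 := congrArg e hd
      rw [map_smul, map_smul, e.apply_symm_apply, ← hφ, smul_eq_mul, mul_one, smul_eq_mul] at h1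
      exact hs (p.isPrime.mem_of_pow_mem 2 (h1 ▸ p.asIdeal.mul_mem_left d hmem))
  refine ⟨{ carrier := P, form := φ, form_self := hself, bijective := ⟨?_, ?_⟩ },
    ⟨LinearEquiv.refl A P⟩⟩
  · refine (injective_iff_map_eq_zero φ).2 fun x hx => ?_
    have htop : LinearMap.ker (LinearMap.toSpanSingleton A _ x) = ⊤ := by
      refine Ideal.eq_top_of_forall_prime_exists _ fun p => ?_
      obtain ⟨s, hs, x₀, x₁, g₀, g₁, hy, hu⟩ := frame p
      have h0 : s * φ x x₁ = g₀ x * φ x₀ x₁ := by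
        have := congrArg (fun y => φ y x₁) (hy x)
        simpa [hself] using this
      have h1 : s * φ x₀ x = g₁ x * φ x₀ x₁ := by
        have := congrArg (φ x₀) (hy x)
        simpa [hself] using this
      rw [hx, LinearMap.zero_apply, mul_zero] at h0
      rw [hneg, hx, LinearMap.zero_apply, neg_zero, mul_zero] at h1
      refine ⟨φ x₀ x₁ * s, ?_, fun hmem => (p.isPrime.mem_or_mem hmem).elim hu hs⟩
      rw [LinearMap.mem_ker, LinearMap.toSpanSingleton_apply, mul_smul, hy, smul_add, smul_smul,
        smul_smul, mul_comm, ← h0, mul_comm, ← h1, zero_smul, zero_smul, add_zero]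
    simpa using (Ideal.eq_top_iff_one _).1 htop
  · intro f
    have htop : (LinearMap.range φ).colon {f} = ⊤ := by
      refine Ideal.eq_top_of_forall_prime_exists _ fun p => ?_
      obtain ⟨s, hs, x₀, x₁, g₀, g₁, hy, hu⟩ := frame p
      refine ⟨φ x₀ x₁ * s, Submodule.mem_colon_singleton.2
        ⟨s • (f x₁ • x₀ - f x₀ • x₁), LinearMap.ext fun y => ?_⟩,
        fun hmem => (p.isPrime.mem_or_mem hmem).elim hu hs⟩
      have h0 : s * φ x₁ y = -(g₀ y * φ x₀ x₁) := by
        have := congrArg (φ x₁) (hy y)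
        rw [map_add, map_smul, map_smul, map_smul, hself, hneg x₁ x₀] at this
        simpa using this
      have h1 : s * φ x₀ y = g₁ y * φ x₀ x₁ := by
        have := congrArg (φ x₀) (hy y)
        simpa [hself] using this
      have h2 : s * f y = g₀ y * f x₀ + g₁ y * f x₁ := by
        have := congrArg f (hy y)
        simpa using this
      simp only [map_smul, map_sub, LinearMap.smul_apply, LinearMap.sub_apply, smul_eq_mul]
      linear_combination f x₁ * h1 - f x₀ * h0 - φ x₀ x₁ * h2
    simpa using Submodule.mem_colon_singleton.1 ((Ideal.eq_top_iff_one _).1 htop)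

end SymplecticModule

/-! ### Isometries, hyperbolic planes and orthogonal complements -/

namespace SymplecticModule

variable {A : Type u} [CommRing A]

/-- A vector is unimodular if it pairs to `1` with some vector. -/
def IsUnimodular (N : SymplecticModule A) (v : N.carrier) : Prop := ∃ w, N.form v w = 1

/-- The vectors `v` and `v'` lie in the same orbit of the isometry group of `N`. -/
def SameOrbit (N : SymplecticModule A) (v v' : N.carrier) : Prop :=
  ∃ σ : N.carrier ≃ₗ[A] N.carrier, (∀ x y, N.form (σ x) (σ y) = N.form x y) ∧ σ v = v'

/-- The isometry group of `N` acts transitively on unimodular vectors. -/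
def UnimodularTransitive (N : SymplecticModule A) : Prop :=
  ∀ v v', N.IsUnimodular v → N.IsUnimodular v' → N.SameOrbit v v'

theorem SameOrbit.trans {N : SymplecticModule A} {u v w : N.carrier} :
    N.SameOrbit u v → N.SameOrbit v w → N.SameOrbit u w := by
  rintro ⟨σ, hσ, rfl⟩ ⟨τ, hτ, rfl⟩
  exact ⟨σ.trans τ, fun x y => by simp only [LinearEquiv.trans_apply, hτ, hσ], rfl⟩

theorem SameOrbit.symm {N : SymplecticModule A} {u v : N.carrier} :
    N.SameOrbit u v → N.SameOrbit v u := by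
  rintro ⟨σ, hσ, rfl⟩
  exact ⟨σ.symm, fun x y => by rw [← hσ, σ.apply_symm_apply, σ.apply_symm_apply],
    σ.symm_apply_apply u⟩

theorem UnimodularTransitive.of_isometric {N N' : SymplecticModule A}
    (h : N.UnimodularTransitive) : Isometric N N' → N'.UnimodularTransitive := by
  rintro ⟨e, he⟩ v v' ⟨w, hw⟩ ⟨w', hw'⟩
  have he' : ∀ x y, N.form (e.symm x) (e.symm y) = N'.form x y := fun x y => by
    rw [← he, e.apply_symm_apply, e.apply_symm_apply]
  obtain ⟨σ, hσ, hv⟩ := h (e.symm v) (e.symm v') ⟨e.symm w, by rw [he', hw]⟩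
    ⟨e.symm w', by rw [he', hw']⟩
  refine ⟨e.symm.trans (σ.trans e), fun x y => ?_, ?_⟩
  · simp only [LinearEquiv.trans_apply, he, hσ, he']
  · simp only [LinearEquiv.trans_apply, hv, e.apply_symm_apply]

theorem isUnimodular_of_dual {N : SymplecticModule A} {v : N.carrier} {g : Module.Dual A N.carrier}
    (h : g v = 1) : N.IsUnimodular v := by
  obtain ⟨w, rfl⟩ := N.bijective.2 g
  exact ⟨-w, by rw [map_neg, ← N.form_neg, h]⟩

/-- The orthogonal sum of a hyperbolic plane and `M`. -/
abbrev hyp (M : SymplecticModule A) : SymplecticModule A := orthogonalSum (hyperbolic A A) M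

/-- The vector of `H(A) ⊥ M` with coordinates `a`, `b` in the hyperbolic plane and component `m`
in `M`. -/
def hypVec (M : SymplecticModule A) (a b : A) (m : M.carrier) : (hyp M).carrier :=
  ((a, b • LinearMap.id), m)

theorem exists_eq_hypVec (M : SymplecticModule A) (x : (hyp M).carrier) :
    ∃ a b m, x = hypVec M a b m := by
  obtain ⟨⟨a, f⟩, m⟩ := x
  refine ⟨a, f 1, m, ?_⟩
  refine Prod.ext (Prod.ext rfl (LinearMap.ext_ring ?_)) rfl
  exact (mul_one (f 1)).symm

@[simp]
theorem form_hypVec (M : SymplecticModule A) (a b a' b' : A) (m m' : M.carrier) :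
    (hyp M).form (hypVec M a b m) (hypVec M a' b' m') = b * a' - b' * a + M.form m m' := rfl

theorem hypVec_add (M : SymplecticModule A) (a b a' b' : A) (m m' : M.carrier) :
    hypVec M a b m + hypVec M a' b' m' = hypVec M (a + a') (b + b') (m + m') :=
  Prod.ext (Prod.ext rfl (add_smul b b' _).symm) rfl

theorem smul_hypVec (M : SymplecticModule A) (c a b : A) (m : M.carrier) :
    c • hypVec M a b m = hypVec M (c * a) (c * b) (c • m) :=
  Prod.ext (Prod.ext rfl (smul_smul c b _)) rfl

/-- A unimodular vector `v`, together with a vector `w` such that `⟨v, w⟩ = 1`, spans a hyperbolic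
plane, and the orthogonal complement of the plane is a complementary symplectic module. -/
theorem exists_isometry_hyp {N : SymplecticModule A} {v : N.carrier} (hv : N.IsUnimodular v) :
    ∃ (M : SymplecticModule A) (e : N.carrier ≃ₗ[A] (hyp M).carrier),
      (∀ x y, (hyp M).form (e x) (e y) = N.form x y) ∧ e v = hypVec M 1 0 0 := by
  obtain ⟨w, hvw⟩ := hv
  have hwv : N.form w v = -1 := by rw [N.form_neg, hvw]
  let S : Submodule A N.carrier := LinearMap.ker (N.form v) ⊓ LinearMap.ker (N.form w)
  have hS1 : ∀ n : S, N.form v n = 0 := fun n => n.2.1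
  have hS2 : ∀ n : S, N.form w n = 0 := fun n => n.2.2
  have hS3 : ∀ n : S, N.form n v = 0 := fun n => by rw [N.form_neg, hS1, neg_zero]
  have hS4 : ∀ n : S, N.form n w = 0 := fun n => by rw [N.form_neg, hS2, neg_zero]
  -- the orthogonal projection to the complement of the plane
  let π : N.carrier →ₗ[A] S := LinearMap.codRestrict S
    (LinearMap.id + (N.form w).smulRight v - (N.form v).smulRight w) (fun x => by
      constructor <;> simp [N.form_self, hvw, hwv])
  have hπ : ∀ x, (π x : N.carrier) = x + N.form w x • v - N.form v x • w := fun x => rfl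
  have hπS : ∀ n : S, π n = n := fun n => Subtype.ext (by simp [hπ, hS1, hS2])
  have hform : ∀ (n : S) x, N.form n (π x) = N.form n x := fun n x => by
    simp [hπ, hS3, hS4]
  have hform' : ∀ x (n : S), N.form (π x) n = N.form x n := fun x n => by
    simp [hπ, hS1, hS2]
  have hfin : Module.Finite A S := Module.Finite.of_surjective π fun n => ⟨n, hπS n⟩
  have hproj : Module.Projective A S :=
    Module.Projective.of_split S.subtype π (LinearMap.ext hπS)
  let M : SymplecticModule A :=
    { carrier := S
      form := N.form.compl₁₂ S.subtype S.subtype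
      form_self := fun n => N.form_self n
      bijective := by
        constructor
        · intro n n' h
          refine Subtype.ext (N.bijective.1 (LinearMap.ext fun x => ?_))
          rw [← hform, ← hform n']
          exact LinearMap.congr_fun h (π x)
        · intro f
          obtain ⟨y, hy⟩ := N.bijective.2 (f ∘ₗ π)
          refine ⟨π y, LinearMap.ext fun n => ?_⟩
          exact (hform' y n).trans (by rw [hy, LinearMap.comp_apply, hπS]) }
  let f : N.carrier →ₗ[A] (hyp M).carrier :=
    LinearMap.prod (LinearMap.prod (-N.form w)
      ((-N.form v).smulRight LinearMap.id)) π
  have hf : ∀ x, f x = hypVec M (-N.form w x) (-N.form v x) (π x) := fun x => rfl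
  let g : (hyp M).carrier →ₗ[A] N.carrier :=
    LinearMap.coprod (LinearMap.coprod (LinearMap.toSpanSingleton A _ v)
      (-(LinearMap.toSpanSingleton A _ w ∘ₗ Module.Dual.eval A A 1))) S.subtype
  have hg : ∀ a b m, g (hypVec M a b m) = a • v + -((b * 1) • w) + m := fun a b m => rfl
  refine ⟨M, LinearEquiv.ofLinearMap f g (LinearMap.ext fun x => ?_) (LinearMap.ext fun x => ?_),
    fun x y => ?_, ?_⟩
  · obtain ⟨a, b, m, rfl⟩ := exists_eq_hypVec M x
    rw [LinearMap.comp_apply, hg, hf, LinearMap.id_apply]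
    congr 1
    · simp [N.form_self, hwv, hS2 m]
    · simp [N.form_self, hvw, hS1 m]
    · refine Subtype.ext ?_
      rw [hπ]
      simp [N.form_self, hvw, hwv, hS1 m, hS2 m]
      abel
  · rw [LinearMap.comp_apply, hf, hg, LinearMap.id_apply, hπ]
    module
  · rw [LinearEquiv.coe_ofLinearMap, hf, hf, form_hypVec]
    change _ + N.form (π x) (π y) = _
    rw [hform', hπ]
    simp only [map_sub, map_add, map_smul, smul_eq_mul]
    rw [N.form_neg x v, N.form_neg x w]
    ring
  · rw [LinearEquiv.coe_ofLinearMap, hf, N.form_self, hwv, neg_neg, neg_zero]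
    congr 1
    refine Subtype.ext ?_
    rw [hπ, N.form_self, hwv]
    simp

/-- A hyperbolic plane can be cancelled from `H(A) ⊥ P ≅ H(A) ⊥ M` if isometries act transitively
on the unimodular vectors of `H(A) ⊥ M`: the isometry can then be taken to fix the first basis
vector `e` of the plane, and it induces an isometry between the two copies of `e^⊥ / e`. -/
theorem UnimodularTransitive.cancel {M P : SymplecticModule A} (hT : (hyp M).UnimodularTransitive) :
    Isometric (hyp P) (hyp M) → Isometric P M := by
  rintro ⟨e, he⟩
  obtain ⟨σ, hσ, hσv⟩ := hT (e (hypVec P 1 0 0)) (hypVec M 1 0 0)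
    ⟨e (hypVec P 0 (-1) 0), by rw [he, form_hypVec]; simp⟩
    ⟨hypVec M 0 (-1) 0, by rw [form_hypVec]; simp⟩
  let τ := e.trans σ
  have hτ : ∀ x y, (hyp M).form (τ x) (τ y) = (hyp P).form x y := fun x y => by
    simp only [τ, LinearEquiv.trans_apply, hσ, he]
  have hτv : τ (hypVec P 1 0 0) = hypVec M 1 0 0 := hσv
  -- the image of `P` is orthogonal to `τ e = e`, so it has no component along the second vector
  have h1 : ∀ p, ∃ a, τ (hypVec P 0 0 p) = hypVec M a 0 (τ (hypVec P 0 0 p)).2 := fun p => by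
    obtain ⟨a, b, m, h⟩ := exists_eq_hypVec M (τ (hypVec P 0 0 p))
    have h2 := hτ (hypVec P 0 0 p) (hypVec P 1 0 0)
    rw [hτv, h, form_hypVec, form_hypVec] at h2
    have hb : b = 0 := by simpa using h2
    exact ⟨a, by rw [h, hb]; rfl⟩
  have h2 : ∀ m, ∃ a, τ.symm (hypVec M 0 0 m) = hypVec P a 0 (τ.symm (hypVec M 0 0 m)).2 :=
    fun m => by
    obtain ⟨a, b, p, h⟩ := exists_eq_hypVec P (τ.symm (hypVec M 0 0 m))
    have h2 := hτ (hypVec P a b p) (hypVec P 1 0 0)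
    rw [hτv, ← h, τ.apply_symm_apply, form_hypVec, h, form_hypVec] at h2
    have hb : b = 0 := by simpa using h2.symm
    exact ⟨a, by rw [h, hb]; rfl⟩
  have hsmulP : ∀ a p, hypVec P a 0 p = a • hypVec P 1 0 0 + hypVec P 0 0 p := fun a p => by
    rw [smul_hypVec, hypVec_add]; simp
  have hsmulM : ∀ a p, hypVec M a 0 p = a • hypVec M 1 0 0 + hypVec M 0 0 p := fun a p => by
    rw [smul_hypVec, hypVec_add]; simp
  have hτv' : τ.symm (hypVec M 1 0 0) = hypVec P 1 0 0 := by rw [← hτv, τ.symm_apply_apply]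
  let f : P.carrier →ₗ[A] M.carrier :=
    LinearMap.snd A _ _ ∘ₗ τ.toLinearMap ∘ₗ LinearMap.inr A _ _
  let g : M.carrier →ₗ[A] P.carrier :=
    LinearMap.snd A _ _ ∘ₗ τ.symm.toLinearMap ∘ₗ LinearMap.inr A _ _
  have hinrP : ∀ p, LinearMap.inr A (hyperbolic A A).carrier P.carrier p = hypVec P 0 0 p :=
    fun p => Prod.ext (Prod.ext rfl (zero_smul A _).symm) rfl
  have hinrM : ∀ p, LinearMap.inr A (hyperbolic A A).carrier M.carrier p = hypVec M 0 0 p :=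
    fun p => Prod.ext (Prod.ext rfl (zero_smul A _).symm) rfl
  have hf : ∀ p, f p = (τ (hypVec P 0 0 p)).2 := fun p => by rw [← hinrP]; rfl
  have hg : ∀ m, g m = (τ.symm (hypVec M 0 0 m)).2 := fun m => by rw [← hinrM]; rfl
  refine ⟨LinearEquiv.ofLinearMap f g (LinearMap.ext fun m => ?_) (LinearMap.ext fun p => ?_),
    fun x y => ?_⟩
  · obtain ⟨a, ha⟩ := h2 m
    rw [← hg, hsmulP] at ha
    have h3 : hypVec P 0 0 (g m) = τ.symm (hypVec M 0 0 m) - a • hypVec P 1 0 0 := by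
      rw [ha]; abel
    rw [LinearMap.comp_apply, hf, h3, map_sub, map_smul, hτv, τ.apply_symm_apply]
    change m - a • (0 : M.carrier) = m
    simp
  · obtain ⟨a, ha⟩ := h1 p
    rw [← hf, hsmulM] at ha
    have h3 : hypVec M 0 0 (f p) = τ (hypVec P 0 0 p) - a • hypVec M 1 0 0 := by
      rw [ha]; abel
    rw [LinearMap.comp_apply, hg, h3, map_sub, map_smul, hτv', τ.symm_apply_apply]
    change p - a • (0 : P.carrier) = p
    simp
  · obtain ⟨a, ha⟩ := h1 x
    obtain ⟨b, hb⟩ := h1 y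
    have h3 := hτ (hypVec P 0 0 x) (hypVec P 0 0 y)
    rw [ha, hb, form_hypVec, form_hypVec, ← hf, ← hf] at h3
    simpa using h3

/-! ### Transitivity on unimodular vectors -/

/-- The transvection `x ↦ x + ⟨x, e⟩ q + ⟨x, q⟩ e + c ⟨x, e⟩ e` with `e` and `q` orthogonal. -/
theorem sameOrbit_transvection (N : SymplecticModule A) {e q : N.carrier} (heq : N.form e q = 0)
    (c : A) (x : N.carrier) :
    N.SameOrbit x (x + N.form x e • q + N.form x q • e + (c * N.form x e) • e) := by
  have hqe : N.form q e = 0 := by rw [N.form_neg, heq, neg_zero]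
  let T : N.carrier → A → N.carrier →ₗ[A] N.carrier := fun q c =>
    LinearMap.id - (N.form e).smulRight q - (N.form q).smulRight e - (c • N.form e).smulRight e
  have hT : ∀ q c x, T q c x = x + N.form x e • q + N.form x q • e + (c * N.form x e) • e := by
    intro q c x
    rw [N.form_neg x e, N.form_neg x q]
    change x - N.form e x • q - N.form q x • e - (c * N.form e x) • e = _
    module
  -- the inverse is the transvection with `-q` and `-c`
  refine ⟨LinearEquiv.ofLinearMap (T q c) (T (-q) (-c)) (LinearMap.ext fun x => ?_)
    (LinearMap.ext fun x => ?_), fun x y => ?_, hT q c x⟩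
  · simp only [LinearMap.comp_apply, hT, map_add, map_smul, map_neg, LinearMap.add_apply,
      LinearMap.smul_apply, LinearMap.neg_apply, LinearMap.id_apply, N.form_self, heq, hqe]
    module
  · simp only [LinearMap.comp_apply, hT, map_add, map_smul, map_neg, LinearMap.add_apply,
      LinearMap.smul_apply, LinearMap.id_apply, N.form_self, heq, hqe]
    module
  · simp only [LinearEquiv.coe_ofLinearMap, hT, map_add, map_smul, LinearMap.add_apply,
      LinearMap.smul_apply, N.form_self, heq, hqe, smul_eq_mul]
    rw [N.form_neg e y, N.form_neg q y]
    ring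

/-- Transvections along the first basis vector of the hyperbolic plane. -/
theorem sameOrbit_hypVec_left (M : SymplecticModule A) (a b c : A) (m q : M.carrier) :
    (hyp M).SameOrbit (hypVec M a b m) (hypVec M (a + M.form m q + c * b) b (m + b • q)) := by
  have := sameOrbit_transvection (hyp M) (e := hypVec M 1 0 0) (q := hypVec M 0 0 q)
    (by rw [form_hypVec]; simp) c (hypVec M a b m)
  rw [form_hypVec, form_hypVec] at this
  simp only [smul_hypVec, hypVec_add] at this
  convert this using 2 <;> simp

/-- Transvections along the second basis vector of the hyperbolic plane. -/
theorem sameOrbit_hypVec_right (M : SymplecticModule A) (a b c : A) (m q : M.carrier) :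
    (hyp M).SameOrbit (hypVec M a b m) (hypVec M a (b - M.form m q - c * a) (m + a • q)) := by
  have := sameOrbit_transvection (hyp M) (e := hypVec M 0 1 0) (q := hypVec M 0 0 (-q))
    (by rw [form_hypVec]; simp) c (hypVec M a b m)
  rw [form_hypVec, form_hypVec] at this
  simp only [smul_hypVec, hypVec_add] at this
  convert this using 2
  · simp
  · simp; ring
  · simp

theorem isUnimodular_of_forall_prime {M : SymplecticModule A} {m : M.carrier}
    (h : ∀ p : PrimeSpectrum A, ¬ ∀ g : Module.Dual A M.carrier, g m ∈ p.asIdeal) :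
    M.IsUnimodular m := by
  have htop : LinearMap.range (Module.Dual.eval A M.carrier m) = ⊤ := by
    refine Ideal.eq_top_of_forall_prime_exists _ fun p => ?_
    obtain ⟨g, hg⟩ := not_forall.1 (h p)
    exact ⟨g m, ⟨g, rfl⟩, hg⟩
  obtain ⟨g, hg⟩ := LinearMap.range_eq_top.1 htop 1
  exact isUnimodular_of_dual hg

/-- If `M` has general position, transvections move each unimodular vector of `H(A) ⊥ M` to the
first basis vector of the hyperbolic plane. -/
theorem sameOrbit_of_generalPosition {M : SymplecticModule A}
    (hM : GeneralPosition A M.carrier) {v : (hyp M).carrier} (hv : (hyp M).IsUnimodular v) :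
    (hyp M).SameOrbit v (hypVec M 1 0 0) := by
  obtain ⟨a, b, m, rfl⟩ := exists_eq_hypVec M v
  have hprime : ∀ p : PrimeSpectrum A, a ∈ p.asIdeal → b ∈ p.asIdeal →
      ¬ ∀ g : Module.Dual A M.carrier, g m ∈ p.asIdeal := by
    intro p ha hb hm
    obtain ⟨w, hw⟩ := hv
    obtain ⟨a', b', m', rfl⟩ := exists_eq_hypVec M w
    rw [form_hypVec] at hw
    refine p.isPrime.ne_top ((Ideal.eq_top_iff_one _).2 ?_)
    rw [← hw, M.form_neg]
    exact add_mem (sub_mem (Ideal.mul_mem_right _ _ hb) (Ideal.mul_mem_left _ _ ha))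
      (neg_mem (hm (M.form m')))
  -- first make the pair of the `M`-component and the first coordinate unimodular
  obtain ⟨q₁, hq₁⟩ := hM m b
  set m₁ := m + b • q₁
  set a₁ := a + M.form m q₁ + 0 * b with ha₁
  have h₁ : (hyp M).SameOrbit (hypVec M a b m) (hypVec M a₁ b m₁) :=
    sameOrbit_hypVec_left M a b 0 m q₁
  -- then make the `M`-component unimodular
  obtain ⟨q₂, hq₂⟩ := hM m₁ a₁
  set m₂ := m₁ + a₁ • q₂
  set b₂ := b - M.form m₁ q₂ - 0 * a₁
  have h₂ : (hyp M).SameOrbit (hypVec M a₁ b m₁) (hypVec M a₁ b₂ m₂) :=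
    sameOrbit_hypVec_right M a₁ b 0 m₁ q₂
  obtain ⟨y, hy⟩ : M.IsUnimodular m₂ := isUnimodular_of_forall_prime fun p hp => by
    obtain ⟨h3, h4⟩ := hq₂ p hp
    obtain ⟨h5, h6⟩ := hq₁ p h4
    refine hprime p ?_ h5 h6
    have h7 : a = a₁ - M.form m q₁ := by rw [ha₁]; ring
    rw [h7, M.form_neg, sub_neg_eq_add]
    exact add_mem h3 (h6 (M.form q₁))
  -- now the first coordinate can be made equal to `1`, and the others are cleared with it
  have h₃ := sameOrbit_hypVec_left M a₁ b₂ 0 m₂ ((1 - a₁) • y)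
  rw [map_smul, hy, smul_eq_mul, mul_one, zero_mul, add_zero, add_sub_cancel] at h₃
  set m₃ := m₂ + b₂ • (1 - a₁) • y
  have h₄ := sameOrbit_hypVec_right M 1 b₂ b₂ m₃ (-m₃)
  rw [map_neg, M.form_self, neg_zero, sub_zero, mul_one, sub_self, one_smul, add_neg_cancel] at h₄
  exact ((h₁.trans h₂).trans h₃).trans h₄

theorem unimodularTransitive_of_generalPosition {M : SymplecticModule A}
    (hM : GeneralPosition A M.carrier) : (hyp M).UnimodularTransitive := fun _ _ hv hv' =>
  (sameOrbit_of_generalPosition hM hv).trans (sameOrbit_of_generalPosition hM hv').symm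

end SymplecticModule

/-! ### Hyperbolic modules and classes of symplectic modules -/

/-- An alternating form on a finitely generated projective module has the shape
`ψ(x, y) - ψ(y, x)`: on a free module, take the strictly upper triangular part of its matrix. -/
theorem LinearMap.exists_eq_sub_flip {A P : Type*} [CommRing A] [AddCommGroup P] [Module A P]
    [Module.Finite A P] [Module.Projective A P] (φ : P →ₗ[A] P →ₗ[A] A) (hφ : ∀ x, φ x x = 0) :
    ∃ ψ : P →ₗ[A] P →ₗ[A] A, ∀ x y, φ x y = ψ x y - ψ y x := by
  have hneg : ∀ x y, φ x y = -φ y x := fun x y => by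
    have := hφ (x + y)
    simp only [map_add, LinearMap.add_apply, hφ] at this
    linear_combination this
  obtain ⟨n, π, s, -, -, hπs⟩ := Module.Finite.exists_comp_eq_id_of_projective A P
  have hs : ∀ x, ∑ i, s x i • π (Pi.single i 1) = x := fun x => by
    rw [← LinearMap.pi_apply_eq_sum_single]; exact LinearMap.congr_fun hπs x
  let m : Fin n → Fin n → A := fun i j => φ (π (Pi.single i 1)) (π (Pi.single j 1))
  let u : Fin n → Fin n → A := fun i j => if i < j then m i j else 0
  have hm : ∀ i j, m i j = u i j - u j i := fun i j => by
    rcases lt_trichotomy i j with h | rfl | h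
    · simp [u, h, h.asymm]
    · simp [u, m, hφ]
    · simp [u, h, h.asymm, m, ← hneg]
  refine ⟨(Matrix.toLinearMap₂' A (Matrix.of u)).compl₁₂ s s, fun x y => ?_⟩
  have h1 : φ x y = ∑ i, ∑ j, s x i * (s y j * m i j) := by
    conv_lhs => rw [← hs x, ← hs y]
    simp only [map_sum, map_smul, LinearMap.sum_apply, LinearMap.smul_apply, smul_eq_mul, m,
      Finset.mul_sum]
    rw [Finset.sum_comm]
    exact Finset.sum_congr rfl fun i _ => Finset.sum_congr rfl fun j _ => by ring
  rw [h1, LinearMap.compl₁₂_apply, LinearMap.compl₁₂_apply, Matrix.toLinearMap₂'_apply,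
    Matrix.toLinearMap₂'_apply, Finset.sum_comm (f := fun i j => s y i • s x j • Matrix.of u i j),
    ← Finset.sum_sub_distrib]
  refine Finset.sum_congr rfl fun i _ => ?_
  rw [← Finset.sum_sub_distrib]
  refine Finset.sum_congr rfl fun j _ => ?_
  rw [hm]
  simp only [Matrix.of_apply, smul_eq_mul]
  ring

namespace SymplecticModule

variable {A : Type u} [CommRing A]

/-- The symplectic module with the opposite form. -/
def opposite (N : SymplecticModule A) : SymplecticModule A where
  carrier := N.carrier
  form := -N.form
  form_self x := by simp [N.form_self]
  bijective := (LinearEquiv.neg A (M := Module.Dual A N.carrier)).bijective.comp N.bijective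

/-- `N ⊥ (-N)` is hyperbolic: the diagonal is Lagrangian, and writing the form of `N` as
`ψ(x, y) - ψ(y, x)` provides a complementary Lagrangian `{(θ x, θ x - x)}`, where `θ` represents
`ψ`. -/
theorem isometric_hyperbolic_orthogonalSum_opposite (N : SymplecticModule A) :
    Isometric (hyperbolic A N.carrier) (orthogonalSum N N.opposite) := by
  obtain ⟨ψ, hψ⟩ := LinearMap.exists_eq_sub_flip N.form N.form_self
  let Φ := LinearEquiv.ofBijective N.form N.bijective
  let θ : N.carrier →ₗ[A] N.carrier := Φ.symm.toLinearMap ∘ₗ ψ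
  have hθ : ∀ x y, N.form (θ x) y = ψ x y := fun x y => by
    have : Φ (θ x) = ψ x := Φ.apply_symm_apply _
    exact LinearMap.congr_fun this y
  let f : N.carrier × Module.Dual A N.carrier →ₗ[A] N.carrier × N.carrier :=
    LinearMap.prod
      (LinearMap.fst A _ _ + θ ∘ₗ Φ.symm.toLinearMap ∘ₗ LinearMap.snd A _ _)
      (LinearMap.fst A _ _ + (θ - LinearMap.id) ∘ₗ Φ.symm.toLinearMap ∘ₗ LinearMap.snd A _ _)
  let g : N.carrier × N.carrier →ₗ[A] N.carrier × Module.Dual A N.carrier :=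
    LinearMap.prod
      (LinearMap.fst A _ _ - θ ∘ₗ (LinearMap.fst A _ _ - LinearMap.snd A _ _))
      (Φ.toLinearMap ∘ₗ (LinearMap.fst A _ _ - LinearMap.snd A _ _))
  have hf : ∀ y x, f (y, Φ x) = (y + θ x, y + (θ x - x)) := fun y x => by
    simp [f]
  have hg : ∀ u v, g (u, v) = (u - θ (u - v), Φ (u - v)) := fun u v => rfl
  have hfg : ∀ u v, f (g (u, v)) = (u, v) := fun u v => by
    rw [hg, hf]
    refine Prod.ext ?_ ?_
    · change u - θ (u - v) + θ (u - v) = u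
      abel
    · change u - θ (u - v) + (θ (u - v) - (u - v)) = v
      abel
  have hgf : ∀ y z, g (f (y, z)) = (y, z) := fun y z => by
    obtain ⟨x, rfl⟩ := Φ.surjective z
    rw [hf, hg]
    have h1 : y + θ x - (y + (θ x - x)) = x := by abel
    rw [h1]
    refine Prod.ext ?_ rfl
    change y + θ x - θ x = y
    abel
  refine ⟨LinearEquiv.ofLinearMap f g (LinearMap.ext fun x => hfg x.1 x.2)
    (LinearMap.ext fun x => hgf x.1 x.2), ?_⟩
  rintro ⟨y, z⟩ ⟨y', z'⟩
  obtain ⟨x, rfl⟩ := Φ.surjective z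
  obtain ⟨x', rfl⟩ := Φ.surjective z'
  change (orthogonalSum N N.opposite).form (f (y, Φ x)) (f (y', Φ x')) = _
  rw [hf, hf]
  change N.form (y + θ x) (y' + θ x') + -N.form (y + (θ x - x)) (y' + (θ x' - x')) =
    N.form x y' - N.form x' y
  have h1 : N.form x (θ x') = -ψ x' x := by rw [N.form_neg, hθ]
  simp only [map_add, map_sub, LinearMap.add_apply, LinearMap.sub_apply, hθ, h1]
  rw [N.form_neg x' y, hψ x x']
  ring

theorem isometric_hyperbolic_of_linearEquiv {Q Q' : Type u} [AddCommGroup Q] [Module A Q]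
    [Module.Finite A Q] [Module.Projective A Q] [AddCommGroup Q'] [Module A Q']
    [Module.Finite A Q'] [Module.Projective A Q'] (e : Q ≃ₗ[A] Q') :
    Isometric (hyperbolic A Q) (hyperbolic A Q') :=
  ⟨LinearEquiv.prodCongr e e.symm.dualMap, fun x y => by
    change x.2 (e.symm (e y.1)) - y.2 (e.symm (e x.1)) = x.2 y.1 - y.2 x.1
    rw [e.symm_apply_apply, e.symm_apply_apply]⟩

theorem isometric_hyperbolic_prod (Q Q' : Type u) [AddCommGroup Q] [Module A Q]
    [Module.Finite A Q] [Module.Projective A Q] [AddCommGroup Q'] [Module A Q']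
    [Module.Finite A Q'] [Module.Projective A Q'] :
    Isometric (orthogonalSum (hyperbolic A Q) (hyperbolic A Q')) (hyperbolic A (Q × Q')) := by
  refine ⟨(LinearEquiv.prodProdProdComm A Q (Module.Dual A Q) Q' (Module.Dual A Q')).trans
    (LinearEquiv.prodCongr (LinearEquiv.refl A (Q × Q')) (LinearMap.coprodEquiv A)), ?_⟩
  rintro ⟨⟨q, f⟩, ⟨q', f'⟩⟩ ⟨⟨r, g⟩, ⟨r', g'⟩⟩
  change (f r + f' r') - (g q + g' q') = (f r - g q) + (f' r' - g' q')
  ring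

/-- The isometry class of a symplectic module. -/
def cls (N : SymplecticModule A) : SymplecticClass A := Quotient.mk _ N

theorem cls_eq_cls {N N' : SymplecticModule A} : N.cls = N'.cls ↔ Isometric N N' := Quotient.eq

theorem cls_orthogonalSum (N N' : SymplecticModule A) :
    (orthogonalSum N N').cls = N.cls + N'.cls := rfl

theorem cls_hyp (M : SymplecticModule A) : M.hyp.cls = (hyperbolic A A).cls + M.cls := rfl

theorem cls_eq_zero_of_subsingleton (N : SymplecticModule A) [Subsingleton N.carrier] :
    N.cls = 0 :=
  cls_eq_cls.2 ⟨⟨0, fun _ => 0, fun _ => Subsingleton.elim _ _, fun _ => rfl⟩, fun x y => by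
    rw [Subsingleton.elim x 0]; simp⟩

theorem cls_hyperbolic_pi (n : ℕ) :
    (hyperbolic A (Fin n → A)).cls = n • (hyperbolic A A).cls := by
  induction n with
  | zero =>
    have : Subsingleton (hyperbolic A (Fin 0 → A)).carrier :=
      inferInstanceAs (Subsingleton ((Fin 0 → A) × Module.Dual A (Fin 0 → A)))
    rw [zero_smul, cls_eq_zero_of_subsingleton]
  | succ n ih =>
    rw [succ_nsmul', ← ih, ← cls_orthogonalSum]
    exact cls_eq_cls.2 ((isometric_hyperbolic_of_linearEquiv
      (Fin.consLinearEquiv A fun _ : Fin (n + 1) => A).symm).trans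
        (isometric_hyperbolic_prod A (Fin n → A)).symm)

/-- Every symplectic module is an orthogonal summand of a sum of hyperbolic planes. -/
theorem exists_cls_add_eq_nsmul (N : SymplecticModule A) :
    ∃ (c : SymplecticClass A) (n : ℕ), N.cls + c = n • (hyperbolic A A).cls := by
  obtain ⟨n, π, s, -, -, hπs⟩ := Module.Finite.exists_comp_eq_id_of_projective A N.carrier
  have hπs' : ∀ x, π (s x) = x := fun x => LinearMap.congr_fun hπs x
  let Q := LinearMap.ker π
  let ρ : (Fin n → A) →ₗ[A] Q := LinearMap.codRestrict Q (LinearMap.id - s ∘ₗ π)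
    (fun x => by simp [Q, hπs'])
  have hρ : ∀ x, (ρ x : Fin n → A) = x - s (π x) := fun x => rfl
  have hρQ : ∀ q : Q, ρ q = q := fun q => Subtype.ext (by
    rw [hρ, LinearMap.mem_ker.1 q.2, map_zero, sub_zero])
  have : Module.Finite A Q := Module.Finite.of_surjective ρ fun q => ⟨q, hρQ q⟩
  have : Module.Projective A Q := Module.Projective.of_split Q.subtype ρ (LinearMap.ext hρQ)
  let e : (Fin n → A) ≃ₗ[A] N.carrier × Q :=
    LinearEquiv.ofLinearMap (LinearMap.prod π ρ) (LinearMap.coprod s Q.subtype)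
      (LinearMap.ext fun ⟨x, q⟩ => Prod.ext
        (by simp [hπs', LinearMap.mem_ker.1 q.2])
        (Subtype.ext (by simp [hρ, hπs', LinearMap.mem_ker.1 q.2])))
      (LinearMap.ext fun x => by simp [hρ])
  refine ⟨N.opposite.cls + (hyperbolic A Q).cls, n, ?_⟩
  rw [← add_assoc, ← cls_orthogonalSum,
    ← cls_eq_cls.2 N.isometric_hyperbolic_orthogonalSum_opposite, ← cls_orthogonalSum,
    ← cls_hyperbolic_pi]
  exact cls_eq_cls.2 ((isometric_hyperbolic_prod N.carrier Q).trans
    (isometric_hyperbolic_of_linearEquiv e.symm))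

/-- The local rank of a class of symplectic modules at a prime. -/
noncomputable def rankHom (p : PrimeSpectrum A) : SymplecticClass A →+ ℕ where
  toFun := Quotient.lift (fun N => Module.rankAtStalk (R := A) N.carrier p)
    (by rintro N N' ⟨e, -⟩; exact congrFun (Module.rankAtStalk_eq_of_equiv e) p)
  map_zero' := congrFun (Module.rankAtStalk_eq_zero_of_subsingleton (M := PUnit.{u + 1})) p
  map_add' := by
    rintro ⟨N⟩ ⟨N'⟩
    exact congrFun (Module.rankAtStalk_prod N.carrier N'.carrier) p

theorem rankHom_cls (p : PrimeSpectrum A) (N : SymplecticModule A) :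
    rankHom p N.cls = Module.rankAtStalk (R := A) N.carrier p := rfl

theorem rankHom_hyperbolic (p : PrimeSpectrum A) : rankHom p (hyperbolic A A).cls = 2 := by
  have : Nontrivial A := p.nontrivial
  change Module.rankAtStalk (R := A) (A × Module.Dual A A) p = 2
  rw [Module.rankAtStalk_prod, Module.rankAtStalk_eq_of_equiv (LinearMap.ringLmapEquivSelf A A A),
    Module.rankAtStalk_self]
  rfl

end SymplecticModule

/-! ### Unimodular rows and vectors of hyperbolic modules -/

namespace SymplecticModule

variable {A : Type u} [CommRing A]

/-- The coordinate row of a vector of `H(Aⁿ)`: coordinates in `Aⁿ` followed by those in the dual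
basis. -/
noncomputable def row (n : ℕ) :
    (hyperbolic A (Fin n → A)).carrier ≃ₗ[A] (Fin n ⊕ Fin n → A) :=
  (LinearEquiv.prodCongr (LinearEquiv.refl A (Fin n → A))
    ((Pi.basisFun A (Fin n)).constr A).symm).trans
      (LinearEquiv.sumArrowLequivProdArrow (Fin n) (Fin n) A A).symm

/-- In coordinates, the hyperbolic form is the bilinear form with matrix `J`. -/
theorem form_eq_row (n : ℕ) (x y : (hyperbolic A (Fin n → A)).carrier) :
    (hyperbolic A (Fin n → A)).form x y = row n x ⬝ᵥ J (Fin n) A *ᵥ row n y := by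
  obtain ⟨q, f⟩ := x
  obtain ⟨q', f'⟩ := y
  have hr : ∀ (q : Fin n → A) f, row n (q, f) = Sum.elim q fun i => f (Pi.single i 1) :=
    fun q f => by
      ext i
      rcases i with i | i
      · rfl
      · exact congrArg f (Pi.basisFun_apply A (Fin n) i)
  change f q' - f' q = _
  rw [LinearMap.pi_apply_eq_sum_single f, LinearMap.pi_apply_eq_sum_single f', hr, hr, J,
    Matrix.fromBlocks_mulVec, sumElim_dotProduct_sumElim]
  simp only [Sum.elim_comp_inl, Sum.elim_comp_inr, zero_mulVec, neg_mulVec, one_mulVec, zero_add,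
    add_zero, dotProduct_neg]
  simp only [dotProduct, smul_eq_mul]
  rw [Finset.sum_congr rfl fun i _ => mul_comm (q' i) _]
  ring

theorem isUnimodular_iff_row (n : ℕ) (x : (hyperbolic A (Fin n → A)).carrier) :
    (hyperbolic A (Fin n → A)).IsUnimodular x ↔ Ideal.span (Set.range (row n x)) = ⊤ := by
  rw [Ideal.eq_top_iff_one, Ideal.mem_span_range_iff_exists_fun]
  constructor
  · rintro ⟨w, hw⟩
    rw [form_eq_row, dotProduct_comm] at hw
    exact ⟨_, hw⟩
  · rintro ⟨c, hc⟩
    refine ⟨(row n).symm (-(J (Fin n) A *ᵥ c)), ?_⟩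
    rw [form_eq_row, LinearEquiv.apply_symm_apply, mulVec_neg, mulVec_mulVec, J_squared,
      neg_mulVec, one_mulVec, neg_neg, dotProduct_comm]
    exact hc

/-- Orbits under isometries of `H(Aⁿ)` are orbits of rows under symplectic matrices. -/
theorem sameOrbit_iff_row (n : ℕ) (x y : (hyperbolic A (Fin n → A)).carrier) :
    (hyperbolic A (Fin n → A)).SameOrbit x y ↔
      ∃ M : symplecticGroup (Fin n) A,
        row n x ᵥ* (M : Matrix (Fin n ⊕ Fin n) (Fin n ⊕ Fin n) A) = row n y := by
  constructor
  · rintro ⟨σ, hσ, rfl⟩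
    let T : (Fin n ⊕ Fin n → A) →ₗ[A] (Fin n ⊕ Fin n → A) :=
      (row n).toLinearMap ∘ₗ σ.toLinearMap ∘ₗ (row n).symm.toLinearMap
    let M : Matrix (Fin n ⊕ Fin n) (Fin n ⊕ Fin n) A := Matrix.of fun i => T (Pi.single i 1)
    have hM : ∀ v, v ᵥ* M = T v := fun v => by
      rw [LinearMap.pi_apply_eq_sum_single T v]
      ext j
      simp [vecMul, dotProduct, M]
    have hT : ∀ v w, T v ⬝ᵥ J (Fin n) A *ᵥ T w = v ⬝ᵥ J (Fin n) A *ᵥ w := fun v w => by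
      have h1 := hσ ((row n).symm v) ((row n).symm w)
      rw [form_eq_row, form_eq_row, LinearEquiv.apply_symm_apply,
        LinearEquiv.apply_symm_apply] at h1
      exact h1
    refine ⟨⟨M, SymplecticGroup.mem_iff.2 ?_⟩, ?_⟩
    · ext i j
      have h1 := hT (Pi.single i 1) (Pi.single j 1)
      rw [← hM, ← hM, ← mulVec_transpose M (Pi.single j 1), ← dotProduct_mulVec, mulVec_mulVec,
        mulVec_mulVec] at h1
      simpa [mul_assoc] using h1
    · change row n x ᵥ* M = _
      rw [hM]
      exact congrArg (fun z => row n (σ z)) ((row n).symm_apply_apply x)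
  · rintro ⟨M, hM⟩
    let M' : Matrix (Fin n ⊕ Fin n) (Fin n ⊕ Fin n) A := M
    let N' : Matrix (Fin n ⊕ Fin n) (Fin n ⊕ Fin n) A := (M⁻¹ : symplecticGroup (Fin n) A)
    have h1 : M' * N' = 1 := congrArg Subtype.val (mul_inv_cancel M)
    have h2 : N' * M' = 1 := congrArg Subtype.val (inv_mul_cancel M)
    let τ : (Fin n ⊕ Fin n → A) ≃ₗ[A] (Fin n ⊕ Fin n → A) :=
      LinearEquiv.ofLinearMap M'.vecMulLinear N'.vecMulLinear
        (LinearMap.ext fun v => by simp [h2]) (LinearMap.ext fun v => by simp [h1])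
    have hτ : ∀ v, τ v = v ᵥ* M' := fun v => rfl
    let σ := ((row n).trans τ).trans (row n).symm
    have hσ : ∀ z, row n (σ z) = row n z ᵥ* M' := fun z => by
      simp only [σ, LinearEquiv.trans_apply, LinearEquiv.apply_symm_apply, hτ]
    refine ⟨σ, fun z w => ?_, (row n).injective ?_⟩
    · rw [form_eq_row, form_eq_row]
      have h3 : M' * J (Fin n) A * M'ᵀ = J (Fin n) A := SymplecticGroup.mem_iff.1 M.2
      change row n (σ z) ⬝ᵥ J (Fin n) A *ᵥ row n (σ w) = _
      rw [hσ, hσ, ← mulVec_transpose M' (row n w), ← dotProduct_mulVec, mulVec_mulVec,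
        mulVec_mulVec, h3]
    · exact (hσ x).trans hM

/-- `Sp_{2n}(A)` has exactly one orbit on unimodular rows if and only if the isometries of `H(Aⁿ)`
act transitively on unimodular vectors. -/
theorem nonempty_unique_unimodularOrbits_iff (n : ℕ) (hn : 0 < n) :
    Nonempty (Unique (UnimodularOrbits n A)) ↔
      (hyperbolic A (Fin n → A)).UnimodularTransitive := by
  have orbit_eq : ∀ v w : UnimodularRow (Fin n ⊕ Fin n) A,
      (Quotient.mk'' v : UnimodularOrbits n A) = Quotient.mk'' w ↔
        ∃ M : symplecticGroup (Fin n) A,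
          w.1 ᵥ* (M : Matrix (Fin n ⊕ Fin n) (Fin n ⊕ Fin n) A) = v.1 := by
    intro v w
    refine Quotient.eq''.trans (MulAction.orbitRel_apply.trans ?_)
    constructor
    · rintro ⟨M, rfl⟩
      exact ⟨M.unop, rfl⟩
    · rintro ⟨M, hM⟩
      exact ⟨MulOpposite.op M, Subtype.ext hM⟩
  constructor
  · rintro ⟨hu⟩ x y hx hy
    rw [sameOrbit_iff_row]
    exact (orbit_eq ⟨row n y, (isUnimodular_iff_row n y).1 hy⟩
      ⟨row n x, (isUnimodular_iff_row n x).1 hx⟩).1 (Subsingleton.elim _ _)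
  · intro h
    have hsub : Subsingleton (UnimodularOrbits n A) := ⟨fun a b => by
      induction a using Quotient.inductionOn'
      induction b using Quotient.inductionOn'
      rename_i v w
      have hrow : ∀ v : UnimodularRow (Fin n ⊕ Fin n) A,
          (hyperbolic A (Fin n → A)).IsUnimodular ((row n).symm v.1) := fun v => by
        rw [isUnimodular_iff_row]
        exact (congrArg (fun r => Ideal.span (Set.range r))
          ((row n).apply_symm_apply v.1)).trans v.2
      obtain ⟨M, hM⟩ := (sameOrbit_iff_row n _ _).1 (h _ _ (hrow w) (hrow v))
      refine (orbit_eq v w).2 ⟨M, ?_⟩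
      simpa only [LinearEquiv.apply_symm_apply] using hM⟩
    have hne : Nonempty (UnimodularOrbits n A) := ⟨Quotient.mk'' ⟨Pi.single (Sum.inl ⟨0, hn⟩) 1,
      (Ideal.eq_top_iff_one _).2 (Ideal.subset_span ⟨Sum.inl ⟨0, hn⟩, by simp⟩)⟩⟩
    exact ⟨@Unique.mk' _ ⟨hne.some⟩ hsub⟩

/-! ### Cancelling and splitting off hyperbolic planes -/

/-- Over a ring of dimension less than `4` all unimodular vectors of `H(A^{n+2})` are equivalent as
soon as those of `H(A²)` are. -/
theorem unimodularTransitive_hyp_hyperbolic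
    (hdim : ∀ l : LTSeries (PrimeSpectrum A), l.length < 4)
    (h2 : (hyperbolic A (Fin 2 → A)).UnimodularTransitive) (n : ℕ) :
    (hyp (hyperbolic A (Fin (n + 1) → A))).UnimodularTransitive := by
  rcases n with _ | n
  · refine h2.of_isometric (cls_eq_cls.1 ?_)
    rw [cls_hyp, cls_hyperbolic_pi, cls_hyperbolic_pi, zero_add, one_smul, two_smul]
  · refine unimodularTransitive_of_generalPosition
      (generalPosition_of_rankAtStalk hdim fun p => ?_)
    rw [← rankHom_cls, cls_hyperbolic_pi, map_nsmul, rankHom_hyperbolic, smul_eq_mul]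
    omega

/-- A stably hyperbolic module `N` of rank two is a hyperbolic plane: the planes of
`N ⊥ H(A)ⁿ ≅ H(A)ⁿ⁺¹` are cancelled one by one. -/
theorem cls_eq_of_add_nsmul_eq
    (hdim : ∀ l : LTSeries (PrimeSpectrum A), l.length < 4)
    (h2 : (hyperbolic A (Fin 2 → A)).UnimodularTransitive) (N : SymplecticModule A) (n : ℕ)
    (h : N.cls + n • (hyperbolic A A).cls = (n + 1) • (hyperbolic A A).cls) :
    N.cls = (hyperbolic A A).cls := by
  induction n with
  | zero => simpa using h
  | succ n ih =>
    have hiso : Isometric (hyp (orthogonalSum N (hyperbolic A (Fin n → A))))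
        (hyp (hyperbolic A (Fin (n + 1) → A))) := by
      refine cls_eq_cls.1 ?_
      rw [cls_hyp, cls_hyp, cls_orthogonalSum, cls_hyperbolic_pi, cls_hyperbolic_pi,
        ← succ_nsmul', ← h, succ_nsmul']
      abel
    have := cls_eq_cls.2 ((unimodularTransitive_hyp_hyperbolic hdim h2 n).cancel hiso)
    rw [cls_orthogonalSum, cls_hyperbolic_pi, cls_hyperbolic_pi] at this
    exact ih this

/-- If the reduced Grothendieck-Witt group vanishes, a symplectic module of rank two is stably a
hyperbolic plane. -/
theorem exists_cls_add_eq_of_subsingleton (hW : Subsingleton (ReducedGW2 A)) (p : PrimeSpectrum A)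
    (N : SymplecticModule A) (hN : Module.rankAtStalk (R := A) N.carrier p = 2) :
    ∃ c, N.cls + c = (hyperbolic A A).cls + c := by
  have h0 : (QuotientAddGroup.mk (GW2.mk N) : ReducedGW2 A) = 0 := Subsingleton.elim _ _
  obtain ⟨k, hk⟩ := AddSubgroup.mem_zmultiples_iff.1 ((QuotientAddGroup.eq_zero_iff _).1 h0)
  -- comparing ranks shows that the multiple of the class of the hyperbolic plane is `1`
  let ρ : GW2 A →+ ℤ :=
    Algebra.GrothendieckAddGroup.lift ((Nat.castAddMonoidHom ℤ).comp (rankHom p))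
  have hρ : ∀ N' : SymplecticModule A, ρ (GW2.mk N') = (rankHom p N'.cls : ℤ) := fun N' =>
    DFunLike.congr_fun (Algebra.GrothendieckAddGroup.lift.symm_apply_apply
      ((Nat.castAddMonoidHom ℤ).comp (rankHom p))) N'.cls
  have h1 := congrArg ρ hk
  rw [map_zsmul, hρ, hρ, rankHom_hyperbolic, rankHom_cls, hN, smul_eq_mul] at h1
  have hk1 : k = 1 := by push_cast at h1; omega
  rw [hk1, one_zsmul] at hk
  obtain ⟨c, hc⟩ := (AddLocalization.addMonoidOf
    (⊤ : AddSubmonoid (SymplecticClass A))).eq_iff_exists.1 hk.symm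
  exact ⟨c, by rw [add_comm, add_comm _ c.1]; exact hc⟩

/-- Vanishing of the reduced Grothendieck-Witt group and transitivity on unimodular vectors of
`H(A²)` make each symplectic module of rank two a hyperbolic plane. -/
theorem cls_eq_of_subsingleton_of_transitive
    (hdim : ∀ l : LTSeries (PrimeSpectrum A), l.length < 4)
    (hW : Subsingleton (ReducedGW2 A))
    (h2 : (hyperbolic A (Fin 2 → A)).UnimodularTransitive) (p : PrimeSpectrum A)
    (N : SymplecticModule A) (hN : Module.rankAtStalk (R := A) N.carrier p = 2) :
    N.cls = (hyperbolic A A).cls := by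
  obtain ⟨c, hc⟩ := exists_cls_add_eq_of_subsingleton hW p N hN
  obtain ⟨R, rfl⟩ : ∃ R : SymplecticModule A, R.cls = c := Quotient.exists_rep c
  obtain ⟨d, n, hd⟩ := R.exists_cls_add_eq_nsmul
  refine cls_eq_of_add_nsmul_eq hdim h2 N n ?_
  rw [succ_nsmul', ← hd, ← add_assoc, hc, add_assoc]

/-- A symplectic module with a unimodular vector and rank two is a hyperbolic plane. -/
theorem cls_eq_of_isUnimodular {N : SymplecticModule A}
    (hN : ∀ p : PrimeSpectrum A, Module.rankAtStalk (R := A) N.carrier p = 2) {v : N.carrier}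
    (hv : N.IsUnimodular v) : N.cls = (hyperbolic A A).cls := by
  obtain ⟨M, e, he, -⟩ := exists_isometry_hyp hv
  have h1 : N.cls = (hyperbolic A A).cls + M.cls := (cls_eq_cls.2 ⟨e, he⟩).trans (cls_hyp M)
  have h2 : Module.rankAtStalk (R := A) M.carrier = 0 := by
    funext p
    have h3 := congrArg (rankHom p) h1
    rw [map_add, rankHom_hyperbolic, rankHom_cls, rankHom_cls, hN] at h3
    simpa using h3
  have := Module.rankAtStalk_eq_zero_iff_subsingleton.1 h2
  rw [h1, M.cls_eq_zero_of_subsingleton, add_zero]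

theorem cls_eq_of_free [Nontrivial A] {N : SymplecticModule A}
    (hN : ∀ p : PrimeSpectrum A, Module.rankAtStalk (R := A) N.carrier p = 2)
    [Module.Free A N.carrier] : N.cls = (hyperbolic A A).cls := by
  have hnt : Nontrivial N.carrier := Module.nontrivial_of_rankAtStalk_pos (R := A)
    ⟨fun p => by simp [hN], fun h => by
      obtain ⟨p⟩ : Nonempty (PrimeSpectrum A) := inferInstance
      simpa [hN] using h p⟩
  let b := Module.Free.chooseBasis A N.carrier
  obtain ⟨i⟩ := b.index_nonempty
  exact cls_eq_of_isUnimodular hN (isUnimodular_of_dual (v := b i) (g := b.coord i) (by simp))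

/-- If symplectic modules of rank two are hyperbolic planes, then every symplectic module of
constant rank is a sum of hyperbolic planes: planes split off while the rank is at least `4`. -/
theorem exists_cls_eq_nsmul (hdim : ∀ l : LTSeries (PrimeSpectrum A), l.length < 4)
    (hrank : ∀ N : SymplecticModule A,
      (∀ p : PrimeSpectrum A, Module.rankAtStalk (R := A) N.carrier p = 2) →
        N.cls = (hyperbolic A A).cls) [Nontrivial A] (r : ℕ) (N : SymplecticModule A)
    (hN : ∀ p : PrimeSpectrum A, Module.rankAtStalk (R := A) N.carrier p = r) :
    ∃ k : ℕ, N.cls = k • (hyperbolic A A).cls := by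
  induction r using Nat.strong_induction_on generalizing N with
  | _ r ih =>
  obtain ⟨p₀⟩ : Nonempty (PrimeSpectrum A) := inferInstance
  rcases Nat.lt_or_ge r 4 with hr | hr
  · interval_cases r
    · have := Module.rankAtStalk_eq_zero_iff_subsingleton.1 (funext hN)
      exact ⟨0, by rw [zero_smul, cls_eq_zero_of_subsingleton]⟩
    · exact absurd (hN p₀) (N.rankAtStalk_ne_one p₀)
    · exact ⟨1, by rw [one_smul, hrank N hN]⟩
    · exact absurd (hN p₀) (N.rankAtStalk_ne_three p₀)
  · obtain ⟨v, g, hg⟩ := (generalPosition_of_rankAtStalk (P := N.carrier) hdim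
      fun p => hr.trans_eq (hN p).symm).exists_dual_apply_eq_one
    obtain ⟨M, e, he, -⟩ := exists_isometry_hyp (isUnimodular_of_dual hg)
    have h1 : N.cls = (hyperbolic A A).cls + M.cls := (cls_eq_cls.2 ⟨e, he⟩).trans (cls_hyp M)
    obtain ⟨k, hk⟩ := ih (r - 2) (by omega) M fun p => by
      have h3 := congrArg (rankHom p) h1
      rw [map_add, rankHom_hyperbolic, rankHom_cls, rankHom_cls, hN] at h3
      omega
    exact ⟨k + 1, by rw [h1, hk, succ_nsmul']⟩

/-- The unimodular vectors of a symplectic module of rank four form one orbit if symplectic modules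
of rank two are hyperbolic planes, since then all orthogonal complements of hyperbolic planes are
isometric. -/
theorem unimodularTransitive_of_rank_four
    (hrank : ∀ N : SymplecticModule A,
      (∀ p : PrimeSpectrum A, Module.rankAtStalk (R := A) N.carrier p = 2) →
        N.cls = (hyperbolic A A).cls) (N : SymplecticModule A)
    (hN : ∀ p : PrimeSpectrum A, Module.rankAtStalk (R := A) N.carrier p = 4) :
    N.UnimodularTransitive := by
  intro v v' hv hv'
  have split : ∀ v, N.IsUnimodular v → ∃ (M : SymplecticModule A)
      (e : N.carrier ≃ₗ[A] (hyp M).carrier),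
      (∀ x y, (hyp M).form (e x) (e y) = N.form x y) ∧ e v = hypVec M 1 0 0 ∧
        M.cls = (hyperbolic A A).cls := fun v hv => by
    obtain ⟨M, e, he, hev⟩ := exists_isometry_hyp hv
    refine ⟨M, e, he, hev, hrank M fun p => ?_⟩
    have h1 := congrArg (rankHom p) ((cls_eq_cls.2 ⟨e, he⟩).trans (cls_hyp M))
    rw [map_add, rankHom_hyperbolic, rankHom_cls, rankHom_cls, hN] at h1
    omega
  obtain ⟨M, e, he, hev, hM⟩ := split v hv
  obtain ⟨M', e', he', hev', hM'⟩ := split v' hv'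
  obtain ⟨f, hf⟩ := cls_eq_cls.1 (hM.trans hM'.symm)
  let F : (hyp M).carrier ≃ₗ[A] (hyp M').carrier :=
    LinearEquiv.prodCongr (LinearEquiv.refl A (hyperbolic A A).carrier) f
  have hF : ∀ x y, (hyp M').form (F x) (F y) = (hyp M).form x y := fun x y =>
    congrArg ((hyperbolic A A).form x.1 y.1 + ·) (hf x.2 y.2)
  have hF1 : F (hypVec M 1 0 0) = hypVec M' 1 0 0 := Prod.ext rfl (map_zero f)
  refine ⟨(e.trans F).trans e'.symm, fun x y => ?_, ?_⟩
  · simp only [LinearEquiv.trans_apply]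
    rw [← he', e'.apply_symm_apply, e'.apply_symm_apply, hF, he]
  · simp only [LinearEquiv.trans_apply]
    rw [hev, hF1, ← hev', e'.symm_apply_apply]

/-- The reduced Grothendieck-Witt group vanishes if all symplectic modules are sums of hyperbolic
planes, since every element of `GW²(A)` is a difference of two classes. -/
theorem subsingleton_reducedGW2
    (h : ∀ N : SymplecticModule A, ∃ k : ℕ, N.cls = k • (hyperbolic A A).cls) :
    Subsingleton (ReducedGW2 A) := by
  have hmem : ∀ c : SymplecticClass A, Algebra.GrothendieckAddGroup.of c ∈
      AddSubgroup.zmultiples (GW2.mk (hyperbolic A A)) := fun c => by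
    obtain ⟨N, rfl⟩ : ∃ N : SymplecticModule A, N.cls = c := Quotient.exists_rep c
    obtain ⟨k, hk⟩ := h N
    rw [hk, map_nsmul]
    exact nsmul_mem (AddSubgroup.mem_zmultiples (GW2.mk (hyperbolic A A))) k
  refine subsingleton_of_forall_eq 0 fun z => ?_
  obtain ⟨z, rfl⟩ := QuotientAddGroup.mk_surjective z
  refine (QuotientAddGroup.eq_zero_iff z).2 ?_
  obtain ⟨⟨c, d⟩, hcd⟩ :=
    (AddLocalization.addMonoidOf (⊤ : AddSubmonoid (SymplecticClass A))).surj z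
  have hz : z = Algebra.GrothendieckAddGroup.of c - Algebra.GrothendieckAddGroup.of d.1 :=
    eq_sub_of_add_eq hcd
  rw [hz]
  exact sub_mem (hmem c) (hmem d.1)

end SymplecticModule

open SymplecticModule in
theorem mainTheorem2 (A : Type u) [CommRing A] [IsNoetherianRing A]
    [ConnectedSpace (PrimeSpectrum A)] (hdim : ringKrullDim A = 3) :
    (∀ (P : Type u) [AddCommGroup P] [Module A P] [Module.Finite A P] [Module.Projective A P],
      (∀ p : PrimeSpectrum A, Module.rankAtStalk P p = 2) →
      Nonempty ((⋀[A]^2 P) ≃ₗ[A] A) →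
      Module.Free A P) ↔
    (Subsingleton (ReducedGW2 A) ∧ Nonempty (Unique (UnimodularOrbits 2 A))) := by
  have hlen : ∀ l : LTSeries (PrimeSpectrum A), l.length < 4 := fun l => by
    have h1 : ((l.length : ℕ) : WithBot ℕ∞) ≤ (3 : ℕ) :=
      (Order.LTSeries.length_le_krullDim l).trans_eq hdim
    have h2 : l.length ≤ 3 := by exact_mod_cast h1
    omega
  obtain ⟨p₀⟩ : Nonempty (PrimeSpectrum A) := inferInstance
  have : Nontrivial A := p₀.nontrivial
  rw [nonempty_unique_unimodularOrbits_iff 2 two_pos]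
  constructor
  · intro hfree
    have hrank : ∀ N : SymplecticModule A,
        (∀ p : PrimeSpectrum A, Module.rankAtStalk (R := A) N.carrier p = 2) →
          N.cls = (hyperbolic A A).cls := fun N hN => by
      have := hfree N.carrier hN (N.nonempty_exteriorPower_equiv hN)
      exact cls_eq_of_free hN
    refine ⟨subsingleton_reducedGW2 fun N => ?_, unimodularTransitive_of_rank_four hrank _
      fun p => ?_⟩
    · have : Module.FinitePresentation A N.carrier := Module.finitePresentation_of_projective A _
      exact exists_cls_eq_nsmul hlen hrank _ N fun p =>
        Module.isLocallyConstant_rankAtStalk.apply_eq_of_preconnectedSpace p p₀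
    · rw [← rankHom_cls, cls_hyperbolic_pi, map_nsmul, rankHom_hyperbolic, smul_eq_mul]
  · rintro ⟨hW, h2⟩ P _ _ _ _ hP ⟨e⟩
    obtain ⟨N, ⟨i⟩⟩ := exists_of_exteriorPower_equiv P hP e
    have hN : Module.rankAtStalk (R := A) N.carrier p₀ = 2 :=
      (congrFun (Module.rankAtStalk_eq_of_equiv i) p₀).trans (hP p₀)
    obtain ⟨f, -⟩ := cls_eq_cls.1 (cls_eq_of_subsingleton_of_transitive hlen hW h2 p₀ N hN)
    have : Module.Free A (hyperbolic A A).carrier :=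
      inferInstanceAs (Module.Free A (A × Module.Dual A A))
    exact Module.Free.of_equiv (f.symm.trans i)
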